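/- There is a universal constant $C<\infty$ with the following property. Let $X_1,\dots,X_n$ ($n\ge 1$) be an i.i.d. sample from a probability measure $P$ on a measurable space $(\mathcal X,\mathcal A)$, and write $\mathbb G_n f=n^{-1/2}\sum_{i=1}^n (f(X_i)-Pf)$, $\|\mathbb G_n\|_{\mathcal F}=\sup_{f\in\mathcal F}|\mathbb G_nf|$, and $\mathrm E_P^*$ for outer expectation. Let $\mathcal F$ be a class of measurable functions $f:\mathcal X\to\mathbb R$ with a measurable envelope function $F$ (that is, $|f|\le F$ for every $f\in\mathcal F$) such that $F\le 1$. Assume that $\mathcal F$ and $\mathcal F^2=\{f^2:f\in\mathcal F\}$ are $P$-measurable, where a class $\mathcal H$ is called $P$-measurable if for all $e_1,\dots,e_n\in\{-1,1\}$ the map $(x_1,\dots,x_n)\mapsto\sup_{h\in\mathcal H}|\sum_{i=1}^n e_ih(x_i)|$ is measurable on the completion of $(\mathcal X^n,\mathcal A^n,P^n)$. Let $\delta\in(0,1)$ be such that $Pf^2<\delta^2PF^2$ for every $f\in\mathcal F$. For $t>0$ let $$J(t,\mathcal F,L_2)=\sup_Q\int_0^t\sqrt{1+\log N(\varepsilon\|F\|_{Q,2},\mathcal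 F,L_2(Q))}\,d\varepsilon,$$ where the supremum is over all finitely discrete probability distributions $Q$ on $(\mathcal X,\mathcal A)$, $\|f\|_{Q,2}$ is the $L_2(Q)$-norm, and $N(\varepsilon,\mathcal F,L_2(Q))$ is the minimal number of closed balls of radius $\varepsilon$ in $L_2(Q)$ needed to cover $\mathcal F$. Then $$\mathrm E_P^*\|\mathbb G_n\|_{\mathcal F}\le C\Bigl[J(\delta,\mathcal F,L_2)\,\|F\|_{P,2}+J^2\Bigl(\frac1{\sqrt n\,\|F\|_{P,2}},\mathcal F,L_2\Bigr)\sqrt n\,\|F\|_{P,2}^2\Bigr].$$ Moreover, whenever $\delta\|F\|_{P,2}\le 1/\sqrt n$, the expression in square brackets is at most $$J(\delta,\mathcal F,L_2)\Bigl(1+\frac{J(\delta,\mathcal F,L_2)}{\delta^2\sqrt n\,\|F\|_{P,2}}\Bigr)\|F\|_{P,2}.$$ -/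

import Mathlib

open MeasureTheory ProbabilityTheory
open scoped ENNReal NNReal

universe u v

namespace LocalMaximal

noncomputable section

/-- The outer expectation `E* Z` of an arbitrary, possibly non-measurable, nonnegative `Z`: the
infimum of `E U` over all measurable `U ≥ Z`. (The integral `∫⁻` of a non-measurable function is
a lower integral, so it cannot be used directly.) -/
def outerExp {Ω : Type*} [MeasurableSpace Ω] (μ : Measure Ω) (Z : Ω → ℝ≥0∞) : ℝ≥0∞ :=
  ⨅ (U : Ω → ℝ≥0∞) (_ : Measurable U) (_ : ∀ ω, Z ω ≤ U ω), ∫⁻ ω, U ω ∂μ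

/-- The empirical process `𝔾ₙ f = n^{-1/2} ∑ᵢ (f (Xᵢ) - P f)`, where `x = (X₁, …, Xₙ)`. -/
def empiricalG {X : Type*} [MeasurableSpace X] (P : Measure X) {n : ℕ} (x : Fin n → X)
    (f : X → ℝ) : ℝ :=
  (1 / √(n : ℝ)) * ∑ i, (f (x i) - ∫ y, f y ∂P)

/-- `‖𝔾ₙ‖_𝓕 = sup_{f ∈ 𝓕} |𝔾ₙ f|`. -/
def supNormG {X : Type*} [MeasurableSpace X] (P : Measure X) {n : ℕ} (x : Fin n → X)
    (𝓕 : Set (X → ℝ)) : ℝ≥0∞ :=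
  ⨆ f ∈ 𝓕, ENNReal.ofReal |empiricalG P x f|

/-- `P`-measurability of the class `𝓕` at sample size `n`: for all signs `e₁, …, eₙ` the map
`x ↦ sup_{f ∈ 𝓕} |∑ᵢ eᵢ f (xᵢ)|` is measurable on the completion of `(Xⁿ, 𝒜ⁿ, Pⁿ)`. -/
def PMeasurable {X : Type*} [MeasurableSpace X] (P : Measure X) (n : ℕ)
    (𝓕 : Set (X → ℝ)) : Prop :=
  ∀ e : Fin n → ℝ, (∀ i, e i = 1 ∨ e i = -1) →
    NullMeasurable (fun x : Fin n → X => ⨆ f ∈ 𝓕, ENNReal.ofReal |∑ i, e i * f (x i)|)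
      (Measure.pi fun _ : Fin n => P)

/-- The class `𝓕² = {f² : f ∈ 𝓕}`. -/
def sqClass {X : Type*} (𝓕 : Set (X → ℝ)) : Set (X → ℝ) :=
  (fun f x => f x ^ 2) '' 𝓕

/-- `F` is an envelope function of `𝓕`. -/
def IsEnvelope {X : Type*} [MeasurableSpace X] (F : X → ℝ) (𝓕 : Set (X → ℝ)) : Prop :=
  Measurable F ∧ ∀ f ∈ 𝓕, ∀ x, |f x| ≤ F x

/-- The real number `‖f‖_{Q,2}` (for `f` in `L₂(Q)`). -/
def l2Norm {X : Type*} [MeasurableSpace X] (Q : Measure X) (f : X → ℝ) : ℝ :=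
  (eLpNorm f 2 Q).toReal

/-- Finitely discrete probability distributions: probability measures that are finite weighted
sums of point masses. -/
def IsFinitelyDiscrete {X : Type*} [MeasurableSpace X] (Q : Measure X) : Prop :=
  IsProbabilityMeasure Q ∧
    ∃ (s : Finset X) (w : X → ℝ≥0∞), Q = ∑ x ∈ s, w x • Measure.dirac x

/-- The covering number `N(ε, 𝓕, L₂(Q))`: the least number of `L₂(Q)`-balls of radius `ε` (with
centres anywhere in `L₂(Q)`) that cover `𝓕`. -/
def coveringNumber {X : Type*} [MeasurableSpace X] (Q : Measure X) (ε : ℝ)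
    (𝓕 : Set (X → ℝ)) : ℕ∞ :=
  Metric.externalCoveringNumber ε.toNNReal {h : Lp ℝ 2 Q | ∃ f ∈ 𝓕, h =ᵐ[Q] f}

/-- `√(1 + log N)`, infinite when `N` is infinite. -/
def sqrtOneAddLog (N : ℕ∞) : ℝ≥0∞ :=
  if N = ⊤ then ⊤ else ENNReal.ofReal √(1 + Real.log (N.toNat : ℝ))

/-- The uniform entropy integral `J(δ, 𝓕 | F, L₂)`
`= sup_Q ∫₀^δ √(1 + log N(ε ‖F‖_{Q,2}, 𝓕, L₂(Q))) dε`, the supremum being over the finitely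
discrete probability distributions `Q`. -/
def entropyIntegral {X : Type*} [MeasurableSpace X] (𝓕 : Set (X → ℝ)) (F : X → ℝ)
    (δ : ℝ) : ℝ≥0∞ :=
  ⨆ (Q : Measure X) (_ : IsFinitelyDiscrete Q),
    ∫⁻ ε in Set.Ioc (0 : ℝ) δ, sqrtOneAddLog (coveringNumber Q (ε * l2Norm Q F) 𝓕)

end

end LocalMaximal

/-! Symmetrization replaces the empirical process by Rademacher sums. Conditionally on the sample,
Dudley chaining bounds these by an entropy integral up to the random radius θ/M, where θ is the
largest empirical L₂ norm in 𝓕 and M that of F. Since the entropy integrand decreases, J(t) ≤ max(1,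
t/s) J(s), so M J(θ/M) ≤ J(w) (M + θ/w) for every deterministic w > 0
(`sum_signVectors_iSup_comp_le`). This bound is linear in M and θ, whose means are controlled by
their second moments.

The second moment of θ is governed by the same inequality for 𝓕², because squaring is 2-Lipschitz on
[-1, 1]. Write N = ‖F‖_{P,2}, b = 1/(√n N), Θ² = E θ² and w = max(Θ/N, δ). Then
`exists_entropy_majorants` gives, after division by √n, the bound 56 J(w) N for the process,
together with the self-bounding inequality w² ≤ δ² + 112 b J(w). Solving it (`le_of_sq_le_add_mul`)
gives J(w) ≤ 150 (J(δ) + J(b)²/b). As N/b = √n N², the constant is 56 · 150 = 8400.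

For N > 0, the condition in the second assertion says δ ≤ b, and then J(b) ≤ (b/δ) J(δ). -/

namespace LocalMaximal

/-! ### Rademacher sums: finite maxima and finite chaining -/

/-- The finite set of sign vectors `{1, -1}ⁿ`. -/
noncomputable def signVectors (n : ℕ) : Finset (Fin n → ℝ) :=
  Fintype.piFinset fun _ => {1, -1}

lemma mem_signVectors {n : ℕ} {e : Fin n → ℝ} :
    e ∈ signVectors n ↔ ∀ i, e i = 1 ∨ e i = -1 := by
  simp [signVectors]

lemma card_signVectors (n : ℕ) : (signVectors n).card = 2 ^ n := by
  have h : (({1, -1} : Finset ℝ)).card = 2 := Finset.card_pair (by norm_num)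
  simp [signVectors, h]

/-- Rademacher sums are sub-Gaussian: the sum over signs factorizes into hyperbolic cosines, and
cosh u ≤ exp(u²/2). -/
lemma sum_signVectors_exp_le {n : ℕ} (v : Fin n → ℝ) :
    ∑ e ∈ signVectors n, Real.exp (∑ i, e i * v i)
      ≤ 2 ^ n * Real.exp ((∑ i, v i ^ 2) / 2) := by
  have h : ∑ e ∈ signVectors n, Real.exp (∑ i, e i * v i)
      = ∏ i, ∑ a ∈ ({1, -1} : Finset ℝ), Real.exp (a * v i) := by
    rw [Finset.prod_univ_sum]
    simp only [Real.exp_sum, signVectors]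
  have h2 : ∀ i, ∑ a ∈ ({1, -1} : Finset ℝ), Real.exp (a * v i) = 2 * Real.cosh (v i) := by
    intro i
    rw [Finset.sum_pair (by norm_num), Real.cosh_eq]
    simp only [one_mul, neg_mul]
    ring
  rw [h, Finset.sum_div, Real.exp_sum]
  calc ∏ i, ∑ a ∈ ({1, -1} : Finset ℝ), Real.exp (a * v i)
      ≤ ∏ i, (2 * Real.exp (v i ^ 2 / 2)) := by
        refine Finset.prod_le_prod (fun i _ => by positivity) (fun i _ => ?_)
        rw [h2]
        exact mul_le_mul_of_nonneg_left (Real.cosh_le_exp_half_sq _) (by norm_num)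
    _ = _ := by simp [Finset.prod_mul_distrib]

/-- Maximal inequality for finitely many Rademacher averages. -/
lemma exists_sum_signVectors_max_le {n : ℕ} (hn : 1 ≤ n) (V : Finset (Fin n → ℝ))
    (hV : V.Nonempty) {a : ℕ} (ha : 1 ≤ a) (hcard : V.card ≤ a ^ 2) {r : ℝ} (hr : 0 < r)
    (hVr : ∀ v ∈ V, ∑ i, v i ^ 2 ≤ n * r ^ 2) :
    ∃ m : (Fin n → ℝ) → ℝ, (∀ e, ∀ v ∈ V, |∑ i, e i * v i| ≤ m e) ∧
      ∑ e ∈ signVectors n, m e ≤ 2 ^ n * (√n * (2 * r * √(1 + Real.log a))) := by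
  obtain ⟨m, hm, hm'⟩ : ∃ m : (Fin n → ℝ) → ℝ, (∀ e, ∀ v ∈ V, |∑ i, e i * v i| ≤ m e) ∧
      ∀ e, ∃ v ∈ V, m e = |∑ i, e i * v i| :=
    ⟨fun e => V.sup' hV fun v => |∑ i, e i * v i|,
      fun e v hv => Finset.le_sup' (fun v => |∑ i, e i * v i|) hv,
      fun e => Finset.exists_mem_eq_sup' hV fun v => |∑ i, e i * v i|⟩
  refine ⟨m, hm, ?_⟩
  have hn0 : (0 : ℝ) < n := by exact_mod_cast hn
  have ha0 : (0 : ℝ) < a := by exact_mod_cast ha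
  have hla : 0 ≤ Real.log a := Real.log_nonneg (by exact_mod_cast ha)
  set s := √(1 + Real.log a) with hs
  have hs0 : 0 < s := Real.sqrt_pos.2 (by linarith)
  have hs2 : s ^ 2 = 1 + Real.log a := Real.sq_sqrt (by linarith)
  have hq0 : 0 < √(n : ℝ) := Real.sqrt_pos.2 hn0
  have hq2 : √(n : ℝ) ^ 2 = n := Real.sq_sqrt hn0.le
  -- With this l the Gaussian exponent l² n r² / 2 equals 2 s², of the same order as the entropy
  -- term log (2 a²).
  set l := 2 * s / (√n * r) with hl
  have hl0 : 0 < l := by positivity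
  set A := 2 * (a : ℝ) ^ 2 * Real.exp (l ^ 2 * (n * r ^ 2) / 2) with hA
  have hA0 : 0 < A := by positivity
  have hexp : ∀ e ∈ signVectors n, Real.exp (l * m e)
      ≤ ∑ v ∈ V, (Real.exp (∑ i, e i * (l * v i)) + Real.exp (∑ i, e i * (-l * v i))) := by
    intro e _
    obtain ⟨v, hv, hve⟩ := hm' e
    have e1 : ∑ i, e i * (l * v i) = l * ∑ i, e i * v i := by
      rw [Finset.mul_sum]; exact Finset.sum_congr rfl fun i _ => by ring
    have e2 : ∑ i, e i * (-l * v i) = l * -∑ i, e i * v i := by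
      rw [← Finset.sum_neg_distrib, Finset.mul_sum]; exact Finset.sum_congr rfl fun i _ => by ring
    have h0 : ∀ v ∈ V,
        0 ≤ Real.exp (∑ i, e i * (l * v i)) + Real.exp (∑ i, e i * (-l * v i)) :=
      fun v _ => (add_pos (Real.exp_pos _) (Real.exp_pos _)).le
    refine le_trans ?_ (Finset.single_le_sum h0 hv)
    rw [hve, e1, e2]
    rcases abs_cases (∑ i, e i * v i) with h | h <;> rw [h.1]
    · linarith [Real.exp_pos (l * -∑ i, e i * v i)]
    · linarith [Real.exp_pos (l * ∑ i, e i * v i)]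
  have hsum : ∑ e ∈ signVectors n, Real.exp (l * m e) ≤ 2 ^ n * A := by
    have hone : ∀ c : ℝ, c ^ 2 = l ^ 2 → ∀ v ∈ V,
        ∑ e ∈ signVectors n, Real.exp (∑ i, e i * (c * v i))
          ≤ 2 ^ n * Real.exp (l ^ 2 * (n * r ^ 2) / 2) := by
      intro c hc v hv
      refine (sum_signVectors_exp_le fun i => c * v i).trans ?_
      gcongr
      calc ∑ i, (c * v i) ^ 2 = l ^ 2 * ∑ i, v i ^ 2 := by
            rw [Finset.mul_sum]; exact Finset.sum_congr rfl fun i _ => by rw [mul_pow, hc]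
        _ ≤ _ := mul_le_mul_of_nonneg_left (hVr v hv) (by positivity)
    refine (Finset.sum_le_sum hexp).trans ?_
    rw [Finset.sum_comm]
    calc _ ≤ ∑ v ∈ V, (2 * (2 ^ n * Real.exp (l ^ 2 * (n * r ^ 2) / 2))) := by
          refine Finset.sum_le_sum fun v hv => ?_
          rw [Finset.sum_add_distrib, two_mul]
          exact add_le_add (hone l rfl v hv) (hone (-l) (by ring) v hv)
      _ = (V.card : ℝ) * (2 * (2 ^ n * Real.exp (l ^ 2 * (n * r ^ 2) / 2))) := by simp
      _ ≤ (a : ℝ) ^ 2 * (2 * (2 ^ n * Real.exp (l ^ 2 * (n * r ^ 2) / 2))) := by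
          gcongr; exact_mod_cast hcard
      _ = _ := by rw [hA]; ring
  -- The tangent line of log at `A` stands in for Jensen's inequality; summed over signs, the
  -- exponential term is at most 2ⁿ by `hsum`.
  have hlin : ∀ e, l * m e ≤ Real.log A - 1 + Real.exp (l * m e) / A := by
    intro e
    have := Real.add_one_le_exp (l * m e - Real.log A)
    rw [Real.exp_sub, Real.exp_log hA0] at this
    linarith
  have hlog : Real.log A ≤ 4 * s ^ 2 := by
    have h1 : Real.log A = Real.log 2 + 2 * Real.log a + l ^ 2 * (n * r ^ 2) / 2 := by
      rw [hA, Real.log_mul (by positivity) (by positivity), Real.log_exp,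
        Real.log_mul (by positivity) (by positivity), Real.log_pow]
      norm_num
    have h2 : l ^ 2 * (n * r ^ 2) = 4 * s ^ 2 := by
      rw [hl, div_pow, mul_pow √(n : ℝ), hq2]; field_simp; ring
    have := Real.log_two_lt_d9
    rw [h1, h2]; nlinarith
  have hfin : l * ∑ e ∈ signVectors n, m e ≤ 2 ^ n * (4 * s ^ 2) := by
    rw [Finset.mul_sum]
    calc _ ≤ ∑ e ∈ signVectors n, (Real.log A - 1 + Real.exp (l * m e) / A) :=
          Finset.sum_le_sum fun e _ => hlin e
      _ = 2 ^ n * (Real.log A - 1) + (∑ e ∈ signVectors n, Real.exp (l * m e)) / A := by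
          rw [Finset.sum_add_distrib, Finset.sum_const, card_signVectors, Finset.sum_div]
          simp
      _ ≤ 2 ^ n * (Real.log A - 1) + 2 ^ n := by
          gcongr; exact (div_le_iff₀ hA0).2 hsum
      _ = 2 ^ n * Real.log A := by ring
      _ ≤ _ := by gcongr
  have : 2 ^ n * (√n * (2 * r * s)) = (2 ^ n * (4 * s ^ 2)) / l := by
    rw [hl]; field_simp; norm_num
  rw [this, le_div_iff₀ hl0]
  linarith

/-- The finite chaining bound, stopped after `K` steps. -/
lemma exists_sum_signVectors_chain_le {n : ℕ} (hn : 1 ≤ n) {T : Set (Fin n → ℝ)}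
    (hT : T.Nonempty) {ρ : ℝ} (hρ : 0 < ρ) (S : ℕ → Finset (Fin n → ℝ)) (hS0 : S 0 = {0})
    (hS : ∀ k, ∀ t ∈ T, ∃ w ∈ S k, ∑ i, (t i - w i) ^ 2 ≤ n * (2 * ρ / 2 ^ k) ^ 2)
    (a : ℕ → ℕ) (ha : ∀ k, (S k).card ≤ a k) (ha' : ∀ k, (S (k + 1)).card ≤ a k) (K : ℕ) :
    ∃ c : (Fin n → ℝ) → ℝ, (∀ e ∈ signVectors n, ∀ t ∈ T, |∑ i, e i * t i| ≤ c e) ∧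
      ∑ e ∈ signVectors n, c e
        ≤ 2 ^ n * (∑ k ∈ Finset.range K, √n * (6 * (ρ / 2 ^ k) * √(1 + Real.log (a k)))
            + n * (2 * ρ / 2 ^ K)) := by
  classical
  have hstep : ∀ k, ∃ m : (Fin n → ℝ) → ℝ,
      (∀ e, ∀ w ∈ S k, ∀ w' ∈ S (k + 1), ∑ i, (w' i - w i) ^ 2 ≤ n * (3 * (ρ / 2 ^ k)) ^ 2 →
        |∑ i, e i * (w' i - w i)| ≤ m e) ∧
      ∑ e ∈ signVectors n, m e ≤ 2 ^ n * (√n * (6 * (ρ / 2 ^ k) * √(1 + Real.log (a k)))) := by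
    intro k
    set V := ((S k ×ˢ S (k + 1)).image fun p => p.2 - p.1).filter
      fun v => ∑ i, v i ^ 2 ≤ n * (3 * (ρ / 2 ^ k)) ^ 2 with hVdef
    have hmem : ∀ w ∈ S k, ∀ w' ∈ S (k + 1), ∑ i, (w' i - w i) ^ 2 ≤ n * (3 * (ρ / 2 ^ k)) ^ 2 →
        w' - w ∈ V := by
      intro w hw w' hw' h
      exact Finset.mem_filter.2
        ⟨Finset.mem_image.2 ⟨(w, w'), Finset.mem_product.2 ⟨hw, hw'⟩, rfl⟩, h⟩
    have hVne : V.Nonempty := by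
      obtain ⟨t, ht⟩ := hT
      obtain ⟨w, hw, h1⟩ := hS k t ht
      obtain ⟨w', hw', h2⟩ := hS (k + 1) t ht
      refine ⟨w' - w, hmem w hw w' hw' ?_⟩
      -- These weights are optimal for radii in ratio 1 : 2. They give 3 · 1 + (3/2) · 4 = 9, the
      -- square of the triangle-inequality bound 1 + 2.
      have hp : ∀ i, (w' i - w i) ^ 2 ≤ 3 * (t i - w' i) ^ 2 + 3 / 2 * (t i - w i) ^ 2 := by
        intro i
        nlinarith [sq_nonneg (2 * (t i - w' i) + (t i - w i))]
      calc _ ≤ ∑ i, (3 * (t i - w' i) ^ 2 + 3 / 2 * (t i - w i) ^ 2) :=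
            Finset.sum_le_sum fun i _ => hp i
        _ = 3 * ∑ i, (t i - w' i) ^ 2 + 3 / 2 * ∑ i, (t i - w i) ^ 2 := by
            rw [Finset.sum_add_distrib, Finset.mul_sum, Finset.mul_sum]
        _ ≤ 3 * (n * (2 * ρ / 2 ^ (k + 1)) ^ 2) + 3 / 2 * (n * (2 * ρ / 2 ^ k) ^ 2) := by gcongr
        _ = _ := by rw [pow_succ]; field_simp; ring
    have ha1 : 1 ≤ a k := by
      obtain ⟨t, ht⟩ := hT
      obtain ⟨w, hw, -⟩ := hS k t ht
      exact (Finset.card_pos.2 ⟨w, hw⟩).trans_le (ha k)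
    have hVcard : V.card ≤ a k ^ 2 := by
      refine (Finset.card_filter_le _ _).trans (Finset.card_image_le.trans ?_)
      rw [Finset.card_product, sq]
      exact Nat.mul_le_mul (ha k) (ha' k)
    obtain ⟨m, hm, hm'⟩ := exists_sum_signVectors_max_le hn V hVne ha1 hVcard
      (r := 3 * (ρ / 2 ^ k)) (by positivity) (fun v hv => (Finset.mem_filter.1 hv).2)
    refine ⟨m, fun e w hw w' hw' h => hm e _ (hmem w hw w' hw' h), hm'.trans_eq (by ring)⟩
  choose m hm hm' using hstep
  refine ⟨fun e => ∑ k ∈ Finset.range K, m k e + n * (2 * ρ / 2 ^ K), ?_, ?_⟩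
  · intro e he t ht
    have hS' := fun k => hS k t ht
    choose w hw hwt using hS'
    have hw0 : w 0 = 0 := by simpa [hS0] using hw 0
    have htel : ∑ i, e i * t i = ∑ k ∈ Finset.range K, ∑ i, e i * (w (k + 1) i - w k i)
        + ∑ i, e i * (t i - w K i) := by
      rw [Finset.sum_comm, ← Finset.sum_add_distrib]
      refine Finset.sum_congr rfl fun i _ => ?_
      rw [← Finset.mul_sum, Finset.sum_range_sub (fun k => w k i), hw0]
      simp; ring
    have hrem : |∑ i, e i * (t i - w K i)| ≤ n * (2 * ρ / 2 ^ K) := by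
      have habs : ∀ i, |e i| = 1 := fun i => by
        rcases mem_signVectors.1 he i with h | h <;> simp [h]
      have h1 : |∑ i, e i * (t i - w K i)| ≤ ∑ i, |t i - w K i| := by
        refine (Finset.abs_sum_le_sum_abs _ _).trans_eq ?_
        simp [abs_mul, habs]
      have h2 : (∑ i, |t i - w K i|) ^ 2 ≤ (n * (2 * ρ / 2 ^ K)) ^ 2 := by
        calc _ ≤ (n : ℝ) * ∑ i, |t i - w K i| ^ 2 := by
              simpa using sq_sum_le_card_mul_sum_sq (s := Finset.univ) (f := fun i => |t i - w K i|)
          _ ≤ n * (n * (2 * ρ / 2 ^ K) ^ 2) := by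
              gcongr; simpa using hwt K
          _ = _ := by ring
      exact h1.trans (abs_le_of_sq_le_sq' h2 (by positivity)).2
    rw [htel]
    refine (abs_add_le _ _).trans (add_le_add ((Finset.abs_sum_le_sum_abs _ _).trans
      (Finset.sum_le_sum fun k _ => hm k e _ (hw k) _ (hw (k + 1)) ?_)) hrem)
    have hp : ∀ i, (w (k + 1) i - w k i) ^ 2
        ≤ 3 * (t i - w (k + 1) i) ^ 2 + 3 / 2 * (t i - w k i) ^ 2 := by
      intro i
      nlinarith [sq_nonneg (2 * (t i - w (k + 1) i) + (t i - w k i))]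
    calc _ ≤ ∑ i, (3 * (t i - w (k + 1) i) ^ 2 + 3 / 2 * (t i - w k i) ^ 2) :=
          Finset.sum_le_sum fun i _ => hp i
      _ = 3 * ∑ i, (t i - w (k + 1) i) ^ 2 + 3 / 2 * ∑ i, (t i - w k i) ^ 2 := by
          rw [Finset.sum_add_distrib, Finset.mul_sum, Finset.mul_sum]
      _ ≤ 3 * (n * (2 * ρ / 2 ^ (k + 1)) ^ 2) + 3 / 2 * (n * (2 * ρ / 2 ^ k) ^ 2) := by
          gcongr
          · exact hwt (k + 1)
          · exact hwt k
      _ = _ := by rw [pow_succ]; field_simp; ring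
  · rw [Finset.sum_add_distrib, Finset.sum_comm, Finset.sum_const, card_signVectors, mul_add,
      Finset.mul_sum]
    refine add_le_add (Finset.sum_le_sum fun k _ => hm' k) (by simp)

/-! ### Integrals of decreasing functions and Dudley's bound -/

lemma sqrtOneAddLog_mono : Monotone sqrtOneAddLog := by
  intro M N h
  unfold sqrtOneAddLog
  by_cases hN : N = ⊤
  · simp [hN]
  have hM : M ≠ ⊤ := fun hM => hN (top_le_iff.1 (hM ▸ h))
  rw [if_neg hN, if_neg hM]
  refine ENNReal.ofReal_le_ofReal (Real.sqrt_le_sqrt ?_)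
  have h' : M.toNat ≤ N.toNat := ENat.toNat_le_toNat h hN
  -- Covering number 0 is harmless: `Real.log 0 = 0`, so its entropy term is 1, the least possible.
  rcases Nat.eq_zero_or_pos M.toNat with h0 | h0
  · rw [h0]
    simpa using Real.log_natCast_nonneg _
  · have : Real.log (M.toNat : ℝ) ≤ Real.log (N.toNat : ℝ) :=
      Real.log_le_log (by exact_mod_cast h0) (by exact_mod_cast h')
    linarith

lemma one_le_sqrtOneAddLog (N : ℕ∞) : 1 ≤ sqrtOneAddLog N := by
  unfold sqrtOneAddLog
  split_ifs
  · exact le_top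
  · rw [ENNReal.one_le_ofReal, Real.one_le_sqrt]
    linarith [Real.log_natCast_nonneg N.toNat]

lemma ofReal_mul_le_setLIntegral_Ioc {φ : ℝ → ℝ≥0∞} (hφ : AntitoneOn φ (Set.Ioi 0)) {a b : ℝ}
    (ha : 0 ≤ a) (hb : 0 < b) :
    ENNReal.ofReal (b - a) * φ b ≤ ∫⁻ ε in Set.Ioc a b, φ ε := by
  calc ENNReal.ofReal (b - a) * φ b = ∫⁻ _ in Set.Ioc a b, φ b := by
        simp [mul_comm]
    _ ≤ _ := setLIntegral_mono' measurableSet_Ioc fun ε hε =>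
        hφ (ha.trans_lt hε.1) hb hε.2

/-- The mean of a decreasing function over (0, t] decreases in t. This comparison is what allows a
random upper limit to be traded for a deterministic one. -/
lemma setLIntegral_Ioc_le_ofReal_mul {φ : ℝ → ℝ≥0∞} (hφ : AntitoneOn φ (Set.Ioi 0)) {s t : ℝ}
    (hs : 0 < s) :
    ∫⁻ ε in Set.Ioc 0 t, φ ε ≤ ENNReal.ofReal (max 1 (t / s)) * ∫⁻ ε in Set.Ioc 0 s, φ ε := by
  rcases le_total t s with h | h
  · have h1 : t / s ≤ 1 := (div_le_one hs).2 h
    rw [max_eq_left h1, ENNReal.ofReal_one, one_mul]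
    exact lintegral_mono_set (Set.Ioc_subset_Ioc_right h)
  · have h1 : 1 ≤ t / s := (one_le_div hs).2 h
    rw [max_eq_right h1, ← Set.Ioc_union_Ioc_eq_Ioc hs.le h]
    refine (lintegral_union_le _ _ _).trans ?_
    have h2 : ∫⁻ ε in Set.Ioc s t, φ ε ≤ ENNReal.ofReal (t - s) * φ s := by
      calc _ ≤ ∫⁻ _ in Set.Ioc s t, φ s := setLIntegral_mono' measurableSet_Ioc fun ε hε =>
            hφ hs (hs.trans hε.1) hε.1.le
        _ = _ := by simp [mul_comm]
    have h3 := ofReal_mul_le_setLIntegral_Ioc hφ le_rfl hs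
    rw [sub_zero] at h3
    have h4 : ENNReal.ofReal (t - s) = ENNReal.ofReal ((t - s) / s) * ENNReal.ofReal s := by
      rw [← ENNReal.ofReal_mul (div_nonneg (sub_nonneg.2 h) hs.le), div_mul_cancel₀ _ hs.ne']
    have h5 : ENNReal.ofReal (t / s) = 1 + ENNReal.ofReal ((t - s) / s) := by
      rw [← ENNReal.ofReal_one, ← ENNReal.ofReal_add zero_le_one
        (div_nonneg (sub_nonneg.2 h) hs.le)]
      congr 1; field_simp; ring
    rw [h5, add_mul, one_mul]
    refine add_le_add le_rfl (h2.trans ?_)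
    rw [h4, mul_assoc]
    gcongr

/-- Each term is at most twice the integral over (ρ/2ᵏ⁺¹, ρ/2ᵏ], and these intervals are disjoint.
-/
lemma sum_ofReal_mul_le_setLIntegral {φ : ℝ → ℝ≥0∞} (hφ : AntitoneOn φ (Set.Ioi 0)) {ρ : ℝ}
    (hρ : 0 < ρ) (K : ℕ) :
    ∑ k ∈ Finset.range K, ENNReal.ofReal (ρ / 2 ^ k) * φ (ρ / 2 ^ k)
      ≤ 2 * ∫⁻ ε in Set.Ioc 0 ρ, φ ε := by
  suffices h : ∑ k ∈ Finset.range K, ENNReal.ofReal (ρ / 2 ^ k) * φ (ρ / 2 ^ k)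
      ≤ 2 * ∫⁻ ε in Set.Ioc (ρ / 2 ^ K) ρ, φ ε by
    refine h.trans ?_
    gcongr
    positivity
  induction K with
  | zero => simp
  | succ K ih =>
    have h0 : 0 < ρ / 2 ^ K := by positivity
    have h1 : ρ / 2 ^ (K + 1) ≤ ρ / 2 ^ K := by gcongr <;> norm_num
    have h2 : ρ / 2 ^ K ≤ ρ := div_le_self hρ.le (one_le_pow₀ (by norm_num))
    have h3 := ofReal_mul_le_setLIntegral_Ioc hφ (a := ρ / 2 ^ (K + 1)) (b := ρ / 2 ^ K)
      (by positivity) h0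
    have h4 : ENNReal.ofReal (ρ / 2 ^ K)
        = 2 * ENNReal.ofReal (ρ / 2 ^ K - ρ / 2 ^ (K + 1)) := by
      rw [← ENNReal.ofReal_ofNat 2, ← ENNReal.ofReal_mul (by norm_num)]
      congr 1; rw [pow_succ]; field_simp; norm_num
    rw [Finset.sum_range_succ, ← Set.Ioc_union_Ioc_eq_Ioc h1 h2,
      lintegral_union measurableSet_Ioc (Set.Ioc_disjoint_Ioc_of_le le_rfl), mul_add, add_comm]
    refine add_le_add ?_ ih
    rw [h4, mul_assoc]
    gcongr

/-- Dudley's entropy bound for the Rademacher process indexed by a set of vectors in `ℝⁿ`. -/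
lemma sum_signVectors_iSup_le {n : ℕ} (hn : 1 ≤ n) (T : Set (Fin n → ℝ)) {ρ : ℝ} (hρ : 0 ≤ ρ)
    (hT : ∀ t ∈ T, ∑ i, t i ^ 2 ≤ n * ρ ^ 2) (N : ℝ → ℕ∞) (hN : AntitoneOn N (Set.Ioi 0))
    (hcov : ∀ ε, 0 < ε → N ε ≠ ⊤ → ∃ S : Finset (Fin n → ℝ), (S.card : ℕ∞) ≤ N ε ∧
      ∀ t ∈ T, ∃ w ∈ S, ∑ i, (t i - w i) ^ 2 ≤ n * ε ^ 2) :
    ∑ e ∈ signVectors n, ⨆ t ∈ T, ENNReal.ofReal |∑ i, e i * t i|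
      ≤ 2 ^ n * (14 * ENNReal.ofReal √n * ∫⁻ ε in Set.Ioc 0 ρ, sqrtOneAddLog (N ε)) := by
  have hn0 : (0 : ℝ) < n := by exact_mod_cast hn
  rcases T.eq_empty_or_nonempty with rfl | hTne
  · simp
  rcases hρ.eq_or_lt with rfl | hρ
  · have h0 : ∀ t ∈ T, ∀ i, t i = 0 := by
      intro t ht i
      have h1 := hT t ht
      have h2 : t i ^ 2 ≤ ∑ i, t i ^ 2 :=
        Finset.single_le_sum (f := fun i => t i ^ 2) (fun i _ => sq_nonneg _) (Finset.mem_univ i)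
      have h3 : t i ^ 2 ≤ 0 := by simpa using h2.trans h1
      exact pow_eq_zero_iff two_ne_zero |>.1 (le_antisymm h3 (sq_nonneg _))
    have : ∑ e ∈ signVectors n, ⨆ t ∈ T, ENNReal.ofReal |∑ i, e i * t i| = 0 := by
      refine Finset.sum_eq_zero fun e _ => ?_
      simp only [ENNReal.iSup_eq_zero]
      intro t ht
      simp [h0 t ht]
    rw [this]; exact zero_le
  set φ : ℝ → ℝ≥0∞ := fun ε => sqrtOneAddLog (N ε) with hφdef
  have hφ : AntitoneOn φ (Set.Ioi 0) := fun x hx y hy h => sqrtOneAddLog_mono (hN hx hy h)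
  have hpos : ∀ k : ℕ, 0 < ρ / 2 ^ k := fun k => by positivity
  have hle : ∀ k : ℕ, ρ / 2 ^ k ≤ ρ := fun k =>
    div_le_self hρ.le (one_le_pow₀ (by norm_num))
  -- An infinite covering number at one dyadic scale is infinite at all smaller ones, which makes
  -- the integral infinite.
  by_cases htop : ∃ k : ℕ, N (ρ / 2 ^ k) = ⊤
  · obtain ⟨k, hk⟩ := htop
    have h1 := ofReal_mul_le_setLIntegral_Ioc hφ le_rfl (hpos k)
    have h2 : φ (ρ / 2 ^ k) = ⊤ := by simp [hφdef, hk, sqrtOneAddLog]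
    rw [h2, sub_zero, ENNReal.mul_top (by simpa using hpos k), top_le_iff] at h1
    have h3 : ∫⁻ ε in Set.Ioc 0 ρ, φ ε = ⊤ :=
      top_le_iff.1 (h1 ▸ lintegral_mono_set (Set.Ioc_subset_Ioc_right (hle k)))
    rw [h3, ENNReal.mul_top (by simp [hn0]), ENNReal.mul_top (by simp)]
    exact le_top
  push Not at htop
  have hnet := fun k : ℕ => hcov _ (hpos k) (htop k)
  choose R hR hRc using hnet
  -- The index is shifted: level k + 1 uses the net of radius ρ/2ᵏ, and level 0 is the origin, so
  -- that `a k` bounds both ends of the k-th link.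
  set S : ℕ → Finset (Fin n → ℝ) := fun k => Nat.casesOn k {0} R with hSdef
  set a : ℕ → ℕ := fun k => (N (ρ / 2 ^ k)).toNat with hadef
  have hR' : ∀ k, (R k).card ≤ a k := fun k => by
    have := hR k
    rw [← ENat.natCast_toNat (htop k)] at this
    exact Nat.cast_le.1 this
  have hamono : ∀ k, a k ≤ a (k + 1) := fun k =>
    ENat.toNat_le_toNat (hN (hpos _) (hpos _) (by gcongr <;> norm_num)) (htop _)
  have ha : ∀ k, (S k).card ≤ a k := by
    intro k
    cases k with
    | zero =>
      obtain ⟨t, ht⟩ := hTne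
      obtain ⟨w, hw, -⟩ := hRc 0 t ht
      have : 1 ≤ (R 0).card := Finset.card_pos.2 ⟨w, hw⟩
      simpa [hSdef] using this.trans (hR' 0)
    | succ k => exact (hR' k).trans (hamono k)
  have hS : ∀ k, ∀ t ∈ T, ∃ w ∈ S k, ∑ i, (t i - w i) ^ 2 ≤ n * (2 * ρ / 2 ^ k) ^ 2 := by
    intro k t ht
    cases k with
    | zero =>
      refine ⟨0, by simp [hSdef], ?_⟩
      have := hT t ht
      simp only [Pi.zero_apply, sub_zero, pow_zero, div_one]
      nlinarith [sq_nonneg ρ]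
    | succ k =>
      obtain ⟨w, hw, h⟩ := hRc k t ht
      refine ⟨w, hw, h.trans_eq ?_⟩
      have : 2 * ρ / 2 ^ (k + 1) = ρ / 2 ^ k := by rw [pow_succ]; field_simp
      rw [this]
  -- Stopping after n links suffices: √n ≤ 2ⁿ leaves a remainder 2 √n ρ, and ρ is below the integral
  -- because the integrand is at least 1. Hence 14 = 6 · 2 + 2.
  obtain ⟨c, hc, hc'⟩ := exists_sum_signVectors_chain_le hn hTne hρ S rfl hS a ha hR' n
  have hcpos : ∀ e ∈ signVectors n, 0 ≤ c e := fun e he =>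
    (abs_nonneg _).trans (hc e he _ hTne.some_mem)
  have hterm : ∀ k, ENNReal.ofReal (ρ / 2 ^ k * √(1 + Real.log (a k)))
      = ENNReal.ofReal (ρ / 2 ^ k) * φ (ρ / 2 ^ k) := by
    intro k
    rw [ENNReal.ofReal_mul (hpos k).le]
    simp [hφdef, sqrtOneAddLog, htop k, hadef]
  have hρint : ENNReal.ofReal ρ ≤ ∫⁻ ε in Set.Ioc 0 ρ, φ ε := by
    calc ENNReal.ofReal ρ = ∫⁻ _ in Set.Ioc 0 ρ, 1 := by simp
      _ ≤ _ := lintegral_mono fun ε => one_le_sqrtOneAddLog _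
  have hrem : (n : ℝ) * (2 * ρ / 2 ^ n) ≤ √n * (2 * ρ) := by
    have h1 : √(n : ℝ) ≤ 2 ^ n := by
      refine (Real.sqrt_le_left (by positivity)).2 ?_
      have : (n : ℝ) ≤ 2 ^ n := by exact_mod_cast Nat.lt_two_pow_self.le
      nlinarith [one_le_pow₀ (one_le_two (α := ℝ)) (n := n)]
    have h2 : (n : ℝ) = √n * √n := (Real.mul_self_sqrt hn0.le).symm
    rw [mul_div_assoc', div_le_iff₀ (by positivity)]
    calc (n : ℝ) * (2 * ρ) = √n * (2 * ρ) * √n := by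
            rw [mul_right_comm, ← h2]
      _ ≤ _ := by gcongr
  calc ∑ e ∈ signVectors n, ⨆ t ∈ T, ENNReal.ofReal |∑ i, e i * t i|
      ≤ ∑ e ∈ signVectors n, ENNReal.ofReal (c e) :=
        Finset.sum_le_sum fun e he => iSup₂_le fun t ht => ENNReal.ofReal_le_ofReal (hc e he t ht)
    _ = ENNReal.ofReal (∑ e ∈ signVectors n, c e) := (ENNReal.ofReal_sum_of_nonneg hcpos).symm
    _ ≤ ENNReal.ofReal (2 ^ n * (√n * (6 * ∑ k ∈ Finset.range n,
          ρ / 2 ^ k * √(1 + Real.log (a k)) + 2 * ρ))) := by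
        refine ENNReal.ofReal_le_ofReal (hc'.trans ?_)
        gcongr
        rw [mul_add, ← mul_assoc, Finset.mul_sum]
        refine add_le_add (Finset.sum_le_sum fun k _ => by apply le_of_eq; ring) hrem
    _ = 2 ^ n * (ENNReal.ofReal √n * (6 * ∑ k ∈ Finset.range n,
          ENNReal.ofReal (ρ / 2 ^ k) * φ (ρ / 2 ^ k) + 2 * ENNReal.ofReal ρ)) := by
        have hs : ∀ k ∈ Finset.range n, 0 ≤ ρ / 2 ^ k * √(1 + Real.log (a k)) :=
          fun k _ => mul_nonneg (hpos k).le (Real.sqrt_nonneg _)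
        have hs' := Finset.sum_nonneg hs
        rw [ENNReal.ofReal_mul (by positivity), ENNReal.ofReal_mul (by positivity),
          ENNReal.ofReal_add (by positivity) (by positivity), ENNReal.ofReal_mul (by norm_num),
          ENNReal.ofReal_mul (by norm_num), ENNReal.ofReal_sum_of_nonneg hs,
          ENNReal.ofReal_pow (by norm_num)]
        simp only [hterm, ENNReal.ofReal_ofNat]
    _ ≤ 2 ^ n * (ENNReal.ofReal √n * (6 * (2 * ∫⁻ ε in Set.Ioc 0 ρ, φ ε)
          + 2 * ∫⁻ ε in Set.Ioc 0 ρ, φ ε)) := by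
        gcongr
        exact sum_ofReal_mul_le_setLIntegral hφ hρ n
    _ = _ := by ring

/-! ### The empirical measure and its nets -/

section EmpiricalMeasure

variable {X : Type*} [MeasurableSpace X] {n : ℕ}

/-- The empirical measure `n⁻¹ ∑ᵢ δ_{xᵢ}`. -/
noncomputable def empiricalMeasure (x : Fin n → X) : Measure X :=
  ∑ i, (n : ℝ≥0∞)⁻¹ • Measure.dirac (x i)

lemma isFinitelyDiscrete_empiricalMeasure (hn : 1 ≤ n) (x : Fin n → X) :
    IsFinitelyDiscrete (empiricalMeasure x) := by
  classical
  refine ⟨⟨?_⟩, Finset.univ.image x,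
    fun y => ∑ _i ∈ Finset.univ.filter fun i => x i = y, (n : ℝ≥0∞)⁻¹, ?_⟩
  · have : (n : ℝ≥0∞) ≠ 0 := by exact_mod_cast (by omega : n ≠ 0)
    simp [empiricalMeasure, ENNReal.mul_inv_cancel this]
  -- Sample points may coincide, so the weights are collected over fibres.
  · rw [empiricalMeasure, ← Finset.sum_fiberwise_of_maps_to (s := Finset.univ)
      (t := Finset.univ.image x) (g := x) (fun i _ => Finset.mem_image_of_mem x (Finset.mem_univ i))]
    refine Finset.sum_congr rfl fun y _ => ?_
    rw [Finset.sum_smul]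
    exact Finset.sum_congr rfl fun i hi => by rw [(Finset.mem_filter.1 hi).2]

lemma eLpNorm_empiricalMeasure (x : Fin n → X) {h : X → ℝ} (hh : Measurable h) :
    eLpNorm h 2 (empiricalMeasure x) = ENNReal.ofReal √((∑ i, h (x i) ^ 2) / n) := by
  have h1 : ∫⁻ y, ‖h y‖ₑ ^ (2 : ℝ) ∂(empiricalMeasure x)
      = ENNReal.ofReal ((∑ i, h (x i) ^ 2) / n) := by
    have hm : Measurable fun y => ‖h y‖ₑ ^ (2 : ℝ) := by fun_prop
    rcases Nat.eq_zero_or_pos n with rfl | hn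
    · simp [empiricalMeasure]
    have hn0 : (0 : ℝ) < n := by exact_mod_cast hn
    rw [empiricalMeasure, lintegral_finsetSum_measure, Finset.sum_div,
      ENNReal.ofReal_sum_of_nonneg (fun i _ => by positivity)]
    refine Finset.sum_congr rfl fun i _ => ?_
    rw [lintegral_smul_measure, lintegral_dirac' _ hm, div_eq_inv_mul,
      ENNReal.ofReal_mul (by positivity), ENNReal.ofReal_inv_of_pos hn0, ENNReal.ofReal_natCast,
      smul_eq_mul, ← sq_abs (h (x i)), ENNReal.ofReal_pow (abs_nonneg _),
      ← Real.enorm_eq_ofReal_abs]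
    norm_cast
  rw [eLpNorm_eq_lintegral_rpow_enorm_toReal (by norm_num) (by norm_num)]
  simp only [ENNReal.toReal_ofNat]
  rw [h1, ENNReal.ofReal_rpow_of_nonneg (by positivity) (by norm_num), Real.sqrt_eq_rpow]

lemma memLp_empiricalMeasure (x : Fin n → X) {h : X → ℝ} (hh : Measurable h) :
    MemLp h 2 (empiricalMeasure x) :=
  ⟨hh.aestronglyMeasurable, by rw [eLpNorm_empiricalMeasure x hh]; exact ENNReal.ofReal_lt_top⟩

lemma l2Norm_empiricalMeasure (x : Fin n → X) {h : X → ℝ} (hh : Measurable h) :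
    l2Norm (empiricalMeasure x) h = √((∑ i, h (x i) ^ 2) / n) := by
  rw [l2Norm, eLpNorm_empiricalMeasure x hh, ENNReal.toReal_ofReal (Real.sqrt_nonneg _)]

lemma coveringNumber_anti (Q : Measure X) (𝓕 : Set (X → ℝ)) {ε ε' : ℝ} (h : ε ≤ ε') :
    coveringNumber Q ε' 𝓕 ≤ coveringNumber Q ε 𝓕 :=
  Metric.externalCoveringNumber_anti (Real.toNNReal_le_toNNReal h)

/-- A finite net for `𝓕` in `L₂` of the empirical measure, as a finite set of vectors. -/
lemma exists_finset_cover_of_coveringNumber_ne_top (hn : 1 ≤ n) (x : Fin n → X)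
    {𝓕 : Set (X → ℝ)} (h𝓕 : ∀ f ∈ 𝓕, Measurable f) {ε : ℝ} (hε : 0 < ε)
    (h : coveringNumber (empiricalMeasure x) ε 𝓕 ≠ ⊤) :
    ∃ S : Finset (Fin n → ℝ), (S.card : ℕ∞) ≤ coveringNumber (empiricalMeasure x) ε 𝓕 ∧
      ∀ f ∈ 𝓕, ∃ w ∈ S, ∑ i, (f (x i) - w i) ^ 2 ≤ n * ε ^ 2 := by
  classical
  have hn0 : (0 : ℝ) < n := by exact_mod_cast hn
  set Q := empiricalMeasure x with hQ
  -- A finite infimum in ℕ∞ is attained; comparing it with itself plus one extracts an optimal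
  -- cover.
  have hlt : coveringNumber Q ε 𝓕 < coveringNumber Q ε 𝓕 + 1 := by
    rw [ENat.lt_add_one_iff h]
  conv_lhs at hlt => rw [coveringNumber, Metric.externalCoveringNumber]
  simp only [iInf_lt_iff] at hlt
  obtain ⟨C, hC, hCcard⟩ := hlt
  rw [ENat.lt_add_one_iff h] at hCcard
  have hfin : C.Finite := Set.finite_of_encard_le_coe
    (hCcard.trans_eq (ENat.natCast_toNat h).symm)
  refine ⟨hfin.toFinset.image fun c i => c (x i), ?_, ?_⟩
  · refine le_trans ?_ hCcard
    rw [hfin.encard_eq_coe_toFinset_card]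
    exact_mod_cast Finset.card_image_le
  · intro f hf
    have hfm := h𝓕 f hf
    have hfL := memLp_empiricalMeasure x hfm
    obtain ⟨c, hc, hfc⟩ := hC (x := hfL.toLp f) ⟨f, hf, hfL.coeFn_toLp⟩
    refine ⟨fun i => c (x i), Finset.mem_image.2 ⟨c, by simpa using hc, rfl⟩, ?_⟩
    have h1 : edist (hfL.toLp f) c ≤ (ε.toNNReal : ℝ≥0∞) := hfc
    have h2 : eLpNorm (f - ⇑c) 2 Q ≤ ENNReal.ofReal ε := by
      rw [Lp.edist_def] at h1
      refine (eLpNorm_congr_ae ?_).trans_le h1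
      exact hfL.coeFn_toLp.symm.sub (ae_eq_refl _)
    have hcm : Measurable (f - ⇑c) := hfm.sub (Lp.stronglyMeasurable c).measurable
    rw [eLpNorm_empiricalMeasure x hcm, ENNReal.ofReal_le_ofReal_iff hε.le,
      Real.sqrt_le_left hε.le, div_le_iff₀ hn0] at h2
    simpa [mul_comm] using h2

end EmpiricalMeasure

/-! ### Conditional entropy bounds for the class and its squares -/

section EntropyBound

variable {X : Type*} [MeasurableSpace X] {n : ℕ}

lemma antitone_sqrtOneAddLog_coveringNumber (Q : Measure X) (𝓕 : Set (X → ℝ)) (F : X → ℝ) :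
    Antitone fun ε => sqrtOneAddLog (coveringNumber Q (ε * l2Norm Q F) 𝓕) := fun _ _ h =>
  sqrtOneAddLog_mono (coveringNumber_anti Q 𝓕
    (mul_le_mul_of_nonneg_right h ENNReal.toReal_nonneg))

lemma entropyIntegral_le_ofReal_mul (𝓕 : Set (X → ℝ)) (F : X → ℝ) {s : ℝ} (t : ℝ) (hs : 0 < s) :
    entropyIntegral 𝓕 F t ≤ ENNReal.ofReal (max 1 (t / s)) * entropyIntegral 𝓕 F s := by
  refine iSup₂_le fun Q hQ => ?_
  refine (setLIntegral_Ioc_le_ofReal_mul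
    ((antitone_sqrtOneAddLog_coveringNumber Q 𝓕 F).antitoneOn _) hs).trans ?_
  gcongr
  exact le_iSup₂_of_le Q hQ le_rfl

lemma ofReal_le_entropyIntegral [Nonempty X] (𝓕 : Set (X → ℝ)) (F : X → ℝ) (t : ℝ) :
    ENNReal.ofReal t ≤ entropyIntegral 𝓕 F t := by
  refine le_iSup₂_of_le _ (isFinitelyDiscrete_empiricalMeasure le_rfl
    fun _ : Fin 1 => Classical.arbitrary X) ?_
  calc ENNReal.ofReal t = ∫⁻ _ in Set.Ioc 0 t, 1 := by simp
    _ ≤ _ := lintegral_mono fun ε => one_le_sqrtOneAddLog _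

/-- Entropy bound for a Rademacher process `f ↦ ∑ᵢ eᵢ ψ (f xᵢ)` with `ψ` a contraction. -/
lemma sum_signVectors_iSup_comp_le (hn : 1 ≤ n) (x : Fin n → X) {𝓕 : Set (X → ℝ)} {F : X → ℝ}
    (h𝓕 : ∀ f ∈ 𝓕, Measurable f) (hF : IsEnvelope F 𝓕) {ψ : ℝ → ℝ} (hψ0 : ψ 0 = 0)
    (hψ : ∀ a b, |ψ a - ψ b| ≤ |a - b|) {θ w : ℝ} (hθ : 0 ≤ θ) (hw : 0 < w)
    (hθf : ∀ f ∈ 𝓕, ∑ i, f (x i) ^ 2 ≤ n * θ ^ 2) :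
    ∑ e ∈ signVectors n, ⨆ f ∈ 𝓕, ENNReal.ofReal |∑ i, e i * ψ (f (x i))|
      ≤ 2 ^ n * (14 * ENNReal.ofReal √n * (entropyIntegral 𝓕 F w *
          (ENNReal.ofReal √((∑ i, F (x i) ^ 2) / n) + ENNReal.ofReal θ / ENNReal.ofReal w))) := by
  have hn0 : (0 : ℝ) < n := by exact_mod_cast hn
  have hψa : ∀ a, |ψ a| ≤ |a| := fun a => by simpa [hψ0] using hψ a 0
  set Q := empiricalMeasure x with hQdef
  set M := √((∑ i, F (x i) ^ 2) / n) with hMdef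
  have hMQ : l2Norm Q F = M := l2Norm_empiricalMeasure x hF.1
  -- If the empirical norm of the envelope is zero, every function of the class vanishes on the
  -- sample, and no normalization is needed.
  rcases (Real.sqrt_nonneg ((∑ i, F (x i) ^ 2) / n)).eq_or_lt with hM | hM
  · have h0 : ∀ f ∈ 𝓕, ∀ i, ψ (f (x i)) = 0 := by
      intro f hf i
      have h1 : ∑ i, F (x i) ^ 2 = 0 := by
        have h2 := (Real.sqrt_eq_zero (by positivity)).1 hM.symm
        simpa [hn0.ne'] using h2
      have h2 : F (x i) ^ 2 ≤ 0 := h1 ▸ Finset.single_le_sum (f := fun i => F (x i) ^ 2)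
        (fun i _ => sq_nonneg _) (Finset.mem_univ i)
      have h3 : F (x i) = 0 := pow_eq_zero_iff two_ne_zero |>.1 (le_antisymm h2 (sq_nonneg _))
      have h4 := hF.2 f hf (x i)
      rw [h3] at h4
      exact abs_eq_zero.1 (le_antisymm ((hψa _).trans h4) (abs_nonneg _))
    have : ∑ e ∈ signVectors n, ⨆ f ∈ 𝓕, ENNReal.ofReal |∑ i, e i * ψ (f (x i))| = 0 := by
      refine Finset.sum_eq_zero fun e _ => ?_
      simp only [ENNReal.iSup_eq_zero]
      intro f hf
      simp [h0 f hf]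
    rw [this]; exact zero_le
  rw [← hMdef] at hM
  set T : Set (Fin n → ℝ) := (fun f i => ψ (f (x i)) / M) '' 𝓕 with hTdef
  have hsq : ∀ u : Fin n → ℝ, ∀ v : Fin n → ℝ, (∀ i, |u i| ≤ |v i|) →
      ∀ c, ∑ i, v i ^ 2 ≤ n * c ^ 2 → ∑ i, (u i / M) ^ 2 ≤ n * (c / M) ^ 2 := by
    intro u v huv c hc
    calc ∑ i, (u i / M) ^ 2 ≤ ∑ i, v i ^ 2 / M ^ 2 := by
          refine Finset.sum_le_sum fun i _ => ?_
          rw [div_pow]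
          gcongr ?_ / _
          exact sq_le_sq.2 (huv i)
      _ = (∑ i, v i ^ 2) / M ^ 2 := by rw [Finset.sum_div]
      _ ≤ n * c ^ 2 / M ^ 2 := by gcongr
      _ = _ := by rw [div_pow, mul_div_assoc]
  have hT : ∀ t ∈ T, ∑ i, t i ^ 2 ≤ n * (θ / M) ^ 2 := by
    rintro _ ⟨f, hf, rfl⟩
    exact hsq _ (fun i => f (x i)) (fun i => hψa _) θ (hθf f hf)
  -- No comparison theorem for Rademacher processes is needed: `ψ` maps nets to nets of the same
  -- radius, so chaining applies directly to the composed class.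
  have hchain := sum_signVectors_iSup_le hn T (div_nonneg hθ hM.le) hT
    (fun ε => coveringNumber Q (ε * M) 𝓕)
    (fun a _ b _ hab => coveringNumber_anti Q 𝓕 (mul_le_mul_of_nonneg_right hab hM.le))
    (by
      intro ε hε hfin
      obtain ⟨S, hS, hSc⟩ := exists_finset_cover_of_coveringNumber_ne_top hn x h𝓕
        (mul_pos hε hM) hfin
      classical
      refine ⟨S.image fun u i => ψ (u i) / M,
        le_trans (by exact_mod_cast Finset.card_image_le) hS, ?_⟩
      rintro _ ⟨f, hf, rfl⟩
      obtain ⟨u, hu, hfu⟩ := hSc f hf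
      refine ⟨_, Finset.mem_image_of_mem _ hu, ?_⟩
      have := hsq (fun i => ψ (f (x i)) - ψ (u i)) (fun i => f (x i) - u i) (fun i => hψ _ _)
        (ε * M) hfu
      rw [mul_div_cancel_right₀ _ hM.ne'] at this
      simpa only [sub_div] using this)
  -- The empirical measure is one of the Q in the supremum, and the sample-dependent limit θ/M is
  -- replaced by w.
  have hJ : ∫⁻ ε in Set.Ioc 0 (θ / M), sqrtOneAddLog (coveringNumber Q (ε * M) 𝓕)
      ≤ ENNReal.ofReal (max 1 (θ / M / w)) * entropyIntegral 𝓕 F w := by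
    refine le_trans ?_ (entropyIntegral_le_ofReal_mul 𝓕 F (θ / M) hw)
    rw [← hMQ]
    exact le_iSup₂_of_le Q (isFinitelyDiscrete_empiricalMeasure hn x) le_rfl
  have hscale : ∀ e : Fin n → ℝ, ⨆ f ∈ 𝓕, ENNReal.ofReal |∑ i, e i * ψ (f (x i))|
      = ENNReal.ofReal M * ⨆ t ∈ T, ENNReal.ofReal |∑ i, e i * t i| := by
    intro e
    rw [hTdef, iSup_image]
    simp only [ENNReal.mul_iSup]
    refine iSup_congr fun f => iSup_congr fun _ => ?_
    rw [← ENNReal.ofReal_mul hM.le]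
    congr 1
    nth_rewrite 1 [← abs_of_pos hM]
    rw [← abs_mul, Finset.mul_sum]
    congr 1
    refine Finset.sum_congr rfl fun i _ => ?_
    field_simp
  have hmax : ENNReal.ofReal M * ENNReal.ofReal (max 1 (θ / M / w))
      ≤ ENNReal.ofReal M + ENNReal.ofReal θ / ENNReal.ofReal w := by
    rw [← ENNReal.ofReal_mul hM.le, ← ENNReal.ofReal_div_of_pos hw,
      ← ENNReal.ofReal_add hM.le (by positivity)]
    refine ENNReal.ofReal_le_ofReal ?_
    have h0 : 0 ≤ θ / M / w := by positivity
    have h1 : max 1 (θ / M / w) ≤ 1 + θ / M / w := max_le (by linarith) (by linarith)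
    calc M * max 1 (θ / M / w) ≤ M * (1 + θ / M / w) := by gcongr
      _ = _ := by field_simp
  simp only [hscale, ← Finset.mul_sum]
  calc _ ≤ ENNReal.ofReal M * (2 ^ n * (14 * ENNReal.ofReal √n *
        (ENNReal.ofReal (max 1 (θ / M / w)) * entropyIntegral 𝓕 F w))) := by
        gcongr
        exact hchain.trans (by gcongr)
    _ = 2 ^ n * (14 * ENNReal.ofReal √n * (entropyIntegral 𝓕 F w *
        (ENNReal.ofReal M * ENNReal.ofReal (max 1 (θ / M / w))))) := by ring
    _ ≤ _ := by gcongr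

lemma sum_signVectors_iSup_class_le (hn : 1 ≤ n) (x : Fin n → X) {𝓕 : Set (X → ℝ)} {F : X → ℝ}
    (h𝓕 : ∀ f ∈ 𝓕, Measurable f) (hF : IsEnvelope F 𝓕) {θ w : ℝ} (hθ : 0 ≤ θ) (hw : 0 < w)
    (hθf : ∀ f ∈ 𝓕, ∑ i, f (x i) ^ 2 ≤ n * θ ^ 2) :
    ∑ e ∈ signVectors n, ⨆ f ∈ 𝓕, ENNReal.ofReal |∑ i, e i * f (x i)|
      ≤ 2 ^ n * (14 * ENNReal.ofReal √n * (entropyIntegral 𝓕 F w *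
          (ENNReal.ofReal √((∑ i, F (x i) ^ 2) / n) + ENNReal.ofReal θ / ENNReal.ofReal w))) :=
  sum_signVectors_iSup_comp_le hn x h𝓕 hF (ψ := id) rfl (fun _ _ => le_rfl) hθ hw hθf

/-- The square is halved to have Lipschitz constant 1, and clipped because net centres may lie
outside [-1, 1]. -/
lemma abs_clip_sq_half_sub_le (a b : ℝ) :
    |(max (-1) (min a 1)) ^ 2 / 2 - (max (-1) (min b 1)) ^ 2 / 2| ≤ |a - b| := by
  have h1 : |max (-1) (min a 1) - max (-1) (min b 1)| ≤ |a - b| :=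
    calc _ ≤ |min a 1 - min b 1| := by
          simpa using abs_max_sub_max_le_max (-1) (min a 1) (-1) (min b 1)
      _ ≤ _ := by simpa using abs_min_sub_min_le_max a 1 b 1
  have h2 : ∀ a : ℝ, |max (-1) (min a 1)| ≤ 1 := fun a =>
    abs_le.2 ⟨le_max_left _ _, max_le (by norm_num) (min_le_right _ _)⟩
  set u := max (-1) (min a 1)
  set v := max (-1) (min b 1)
  have h3 : |u + v| ≤ 2 := (abs_add_le u v).trans (by linarith [h2 a, h2 b])
  have h4 : u ^ 2 / 2 - v ^ 2 / 2 = (u + v) / 2 * (u - v) := by ring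
  rw [h4, abs_mul, abs_div, abs_two]
  nlinarith [abs_nonneg (u - v)]

lemma sum_signVectors_iSup_sqClass_le (hn : 1 ≤ n) (x : Fin n → X) {𝓕 : Set (X → ℝ)} {F : X → ℝ}
    (h𝓕 : ∀ f ∈ 𝓕, Measurable f) (hF : IsEnvelope F 𝓕) (hF1 : ∀ x, F x ≤ 1) {θ w : ℝ}
    (hθ : 0 ≤ θ) (hw : 0 < w) (hθf : ∀ f ∈ 𝓕, ∑ i, f (x i) ^ 2 ≤ n * θ ^ 2) :
    ∑ e ∈ signVectors n, ⨆ g ∈ sqClass 𝓕, ENNReal.ofReal |∑ i, e i * g (x i)|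
      ≤ 2 ^ n * (28 * ENNReal.ofReal √n * (entropyIntegral 𝓕 F w *
          (ENNReal.ofReal √((∑ i, F (x i) ^ 2) / n) + ENNReal.ofReal θ / ENNReal.ofReal w))) := by
  have h := sum_signVectors_iSup_comp_le hn x h𝓕 hF
    (ψ := fun a => (max (-1) (min a 1)) ^ 2 / 2) (by simp)
    abs_clip_sq_half_sub_le hθ hw hθf
  have heq : ∀ e : Fin n → ℝ, ⨆ g ∈ sqClass 𝓕, ENNReal.ofReal |∑ i, e i * g (x i)|
      = 2 * ⨆ f ∈ 𝓕, ENNReal.ofReal |∑ i, e i * ((max (-1) (min (f (x i)) 1)) ^ 2 / 2)| := by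
    intro e
    rw [sqClass, iSup_image]
    simp only [ENNReal.mul_iSup]
    refine iSup_congr fun f => iSup_congr fun hf => ?_
    rw [← ENNReal.ofReal_ofNat 2, ← ENNReal.ofReal_mul (by norm_num)]
    congr 1
    nth_rewrite 1 [← abs_two (α := ℝ)]
    rw [← abs_mul, Finset.mul_sum]
    congr 1
    refine Finset.sum_congr rfl fun i _ => ?_
    have hb := abs_le.1 ((hF.2 f hf (x i)).trans (hF1 _))
    rw [min_eq_left hb.2, max_eq_right hb.1]
    ring
  simp only [heq, ← Finset.mul_sum]
  calc _ ≤ 2 * _ := mul_le_mul_right h 2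
    _ = _ := by ring

end EntropyBound

/-! ### Symmetrization -/

section Symmetrization

/-- Setting the majorant to ∞ on a measurable null set costs nothing. This is how measurability on
the completion yields bounds on outer expectations. -/
lemma exists_measurable_ge_lintegral_eq {α : Type*} [MeasurableSpace α] {μ : Measure α}
    {f : α → ℝ≥0∞} (hf : NullMeasurable f μ) :
    ∃ U : α → ℝ≥0∞, Measurable U ∧ (∀ a, f a ≤ U a) ∧ ∫⁻ a, U a ∂μ = ∫⁻ a, f a ∂μ := by
  classical
  have hf' : AEMeasurable f μ := hf.aemeasurable
  set s := toMeasurable μ {a | f a ≠ hf'.mk f a} with hs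
  have hs0 : μ s = 0 := (measure_toMeasurable _).trans hf'.ae_eq_mk
  have hsm : MeasurableSet s := measurableSet_toMeasurable _ _
  refine ⟨s.piecewise (fun _ => ⊤) (hf'.mk f),
    Measurable.piecewise hsm measurable_const hf'.measurable_mk, fun a => ?_, ?_⟩
  · by_cases ha : a ∈ s
    · simp [ha]
    · have : f a = hf'.mk f a := by
        by_contra h
        exact ha (subset_toMeasurable _ _ h)
      simp [ha, this]
  · refine lintegral_congr_ae ?_
    have h1 : ∀ᵐ a ∂μ, a ∉ s := measure_eq_zero_iff_ae_notMem.1 hs0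
    filter_upwards [h1, hf'.ae_eq_mk] with a ha ha'
    simp [ha, ha']

variable {X : Type*} [MeasurableSpace X] {n : ℕ}

/-- Choosing each coordinate from either of two independent samples gives again a sample; on boxes
the preimage is a product of two boxes. -/
lemma measurePreserving_pi_prod_select (P : Measure X) [IsProbabilityMeasure P] (b : Fin n → Prop)
    [DecidablePred b] :
    MeasurePreserving (fun (p : (Fin n → X) × (Fin n → X)) i => if b i then p.1 i else p.2 i)
      ((Measure.pi fun _ => P).prod (Measure.pi fun _ => P)) (Measure.pi fun _ : Fin n => P) := by
  have hm : Measurable fun (p : (Fin n → X) × (Fin n → X)) i => if b i then p.1 i else p.2 i := by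
    refine measurable_pi_lambda _ fun i => ?_
    split_ifs <;> fun_prop
  refine ⟨hm, (Measure.pi_eq fun s hs => ?_).symm⟩
  rw [Measure.map_apply hm (MeasurableSet.univ_pi hs)]
  have hpre : (fun (p : (Fin n → X) × (Fin n → X)) i => if b i then p.1 i else p.2 i) ⁻¹'
      Set.univ.pi s = (Set.univ.pi fun i => if b i then s i else Set.univ) ×ˢ
        (Set.univ.pi fun i => if b i then Set.univ else s i) := by
    ext p
    simp only [Set.mem_preimage, Set.mem_pi, Set.mem_univ, true_imp_iff, Set.mem_prod]
    rw [← forall_and]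
    refine forall_congr' fun i => ?_
    split_ifs <;> simp
  rw [hpre, Measure.prod_prod, Measure.pi_pi, Measure.pi_pi, ← Finset.prod_mul_distrib]
  refine Finset.prod_congr rfl fun i _ => ?_
  split_ifs <;> simp

/-- Symmetrization with a fixed sign vector. -/
lemma exists_measurable_ge_symmetrized (P : Measure X) [IsProbabilityMeasure P]
    {𝓖 : Set (X → ℝ)} (h𝓖 : ∀ g ∈ 𝓖, Integrable g P) {e : Fin n → ℝ}
    (he : ∀ i, e i = 1 ∨ e i = -1)
    (hnull : NullMeasurable (fun x : Fin n → X => ⨆ g ∈ 𝓖, ENNReal.ofReal |∑ i, e i * g (x i)|)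
      (Measure.pi fun _ : Fin n => P)) :
    ∃ V : (Fin n → X) → ℝ≥0∞, Measurable V ∧
      (∀ x, ∀ g ∈ 𝓖, ENNReal.ofReal |∑ i, (g (x i) - ∫ y, g y ∂P)| ≤ V x) ∧
      ∫⁻ x, V x ∂(Measure.pi fun _ : Fin n => P)
        = 2 * ∫⁻ x, ⨆ g ∈ 𝓖, ENNReal.ofReal |∑ i, e i * g (x i)|
            ∂(Measure.pi fun _ : Fin n => P) := by
  classical
  obtain ⟨U, hU, hSU, hUint⟩ := exists_measurable_ge_lintegral_eq hnull
  set μ := Measure.pi fun _ : Fin n => P with hμ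
  have hp := measurePreserving_pi_prod_select (n := n) P fun i => e i = 1
  have hq := measurePreserving_pi_prod_select (n := n) P fun i => ¬ e i = 1
  set σ := fun (p : (Fin n → X) × (Fin n → X)) i => if e i = 1 then p.1 i else p.2 i with hσ
  set τ := fun (p : (Fin n → X) × (Fin n → X)) i => if ¬ e i = 1 then p.1 i else p.2 i with hτ
  have hW : Measurable fun p => U (σ p) + U (τ p) :=
    (hU.comp hp.measurable).add (hU.comp hq.measurable)
  have hUσ : Measurable fun p => U (σ p) := hU.comp hp.measurable
  -- The integral over `y` averages over an independent ghost sample.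
  refine ⟨fun x => ∫⁻ y, (U (σ (x, y)) + U (τ (x, y))) ∂μ, hW.lintegral_prod_right', ?_, ?_⟩
  · intro x g hg
    have hcomp : ∀ i, Integrable (fun y : Fin n → X => g (y i)) μ := fun i =>
      integrable_comp_eval (h𝓖 g hg)
    have hint : ∑ i, (g (x i) - ∫ y, g y ∂P) = ∫ y, ∑ i, (g (x i) - g (y i)) ∂μ := by
      have hd : ∀ i, Integrable (fun y : Fin n → X => g (x i) - g (y i)) μ := fun i =>
        (integrable_const _).sub (hcomp i)
      rw [integral_finsetSum _ fun i _ => hd i]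
      refine Finset.sum_congr rfl fun i _ => ?_
      rw [integral_sub (integrable_const _) (hcomp i),
        integral_comp_eval (μ := fun _ => P) (h𝓖 g hg).aestronglyMeasurable]
      simp
    rw [hint, ← Real.enorm_eq_ofReal_abs]
    refine (enorm_integral_le_lintegral_enorm _).trans (lintegral_mono fun y => ?_)
    -- The fixed signs are absorbed by exchanging x and y in the coordinates where the sign is -1.
    have hsplit : ∑ i, (g (x i) - g (y i))
        = ∑ i, e i * g (σ (x, y) i) - ∑ i, e i * g (τ (x, y) i) := by
      rw [← Finset.sum_sub_distrib]
      refine Finset.sum_congr rfl fun i _ => ?_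
      rcases he i with h | h
      · simp [hσ, hτ, h]
      · have : ¬ ((-1 : ℝ) = 1) := by norm_num
        simp only [hσ, hτ, h, this, if_false, not_false_eq_true, if_true]
        ring
    have hS : ∀ z : Fin n → X, ENNReal.ofReal |∑ i, e i * g (z i)| ≤ U z := fun z =>
      (le_iSup₂_of_le g hg le_rfl).trans (hSU z)
    rw [hsplit, Real.enorm_eq_ofReal_abs]
    calc _ ≤ ENNReal.ofReal (|∑ i, e i * g (σ (x, y) i)| + |∑ i, e i * g (τ (x, y) i)|) :=
          ENNReal.ofReal_le_ofReal (abs_sub _ _)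
      _ ≤ _ := ENNReal.ofReal_add_le.trans (add_le_add (hS _) (hS _))
  · rw [← lintegral_prod _ hW.aemeasurable, lintegral_add_left hUσ,
      hp.lintegral_comp hU, hq.lintegral_comp hU, hUint, two_mul]

/-- Symmetrization: the averaged Rademacher process dominates the empirical process. -/
lemma exists_measurable_ge_symmetrized_average (P : Measure X) [IsProbabilityMeasure P]
    {𝓖 : Set (X → ℝ)} (h𝓖 : ∀ g ∈ 𝓖, Integrable g P) (hP : PMeasurable P n 𝓖) :
    ∃ V : (Fin n → X) → ℝ≥0∞, Measurable V ∧
      (∀ x, ∀ g ∈ 𝓖, ENNReal.ofReal |∑ i, (g (x i) - ∫ y, g y ∂P)| ≤ V x) ∧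
      2 ^ n * ∫⁻ x, V x ∂(Measure.pi fun _ : Fin n => P)
        ≤ 2 * ∫⁻ x, ∑ e ∈ signVectors n, ⨆ g ∈ 𝓖, ENNReal.ofReal |∑ i, e i * g (x i)|
            ∂(Measure.pi fun _ : Fin n => P) := by
  have hnull := fun e (he : e ∈ signVectors n) => hP e (mem_signVectors.1 he)
  have hne : (signVectors n).Nonempty := Finset.card_pos.1 (by simp [card_signVectors])
  -- Symmetrization holds for each sign vector separately, so the minimizing one gives a single
  -- majorant below the average.
  obtain ⟨e, he, hmin⟩ := Finset.exists_min_image (signVectors n)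
    (fun e => ∫⁻ x, ⨆ g ∈ 𝓖, ENNReal.ofReal |∑ i, e i * g (x i)|
      ∂(Measure.pi fun _ : Fin n => P)) hne
  obtain ⟨V, hV, hV', hVint⟩ := exists_measurable_ge_symmetrized P h𝓖 (mem_signVectors.1 he)
    (hnull e he)
  refine ⟨V, hV, hV', ?_⟩
  rw [hVint, lintegral_finsetSum' _ fun e he => (hnull e he).aemeasurable, mul_left_comm]
  gcongr
  have := Finset.card_nsmul_le_sum _ _ _ hmin
  simpa [card_signVectors] using this

end Symmetrization

/-! ### Jensen, inversion of the recursion, outer expectation -/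

lemma sq_lintegral_le_lintegral_sq {α : Type*} [MeasurableSpace α] (μ : Measure α)
    [IsProbabilityMeasure μ] {h : α → ℝ≥0∞} (hh : AEMeasurable h μ) :
    (∫⁻ a, h a ∂μ) ^ 2 ≤ ∫⁻ a, h a ^ 2 ∂μ := by
  have := ENNReal.lintegral_mul_le_Lp_mul_Lq μ Real.HolderConjugate.two_two hh
    (aemeasurable_const (b := (1 : ℝ≥0∞)))
  simp only [Pi.mul_apply, mul_one, ENNReal.rpow_ofNat, one_pow, lintegral_one, measure_univ,
    ENNReal.one_rpow] at this
  calc _ ≤ ((∫⁻ a, h a ^ 2 ∂μ) ^ (1 / 2 : ℝ)) ^ 2 := by gcongr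
    _ = _ := by
      rw [← ENNReal.rpow_ofNat, ← ENNReal.rpow_mul]
      norm_num

/-- Inverting `w² ≤ δ² + 112 b j(w)` for `j` increasing with `j(t)/t` decreasing, up to constants. -/
lemma le_of_sq_le_add_mul {j : ℝ → ℝ} (hj : ∀ s t, 0 < s → j t ≤ max 1 (t / s) * j s)
    (hjt : ∀ t, t ≤ j t) {δ b w : ℝ} (hδ : 0 < δ) (hb : 0 < b) (hw : 0 < w)
    (h : w ^ 2 ≤ δ ^ 2 + 112 * b * j w) :
    j w ≤ 150 * (j δ + j b ^ 2 / b) := by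
  have hjδ : 0 < j δ := hδ.trans_le (hjt δ)
  have hjb : 0 < j b := hb.trans_le (hjt b)
  have hjw : 0 < j w := hw.trans_le (hjt w)
  have hq : 0 < j b ^ 2 / b := by positivity
  rcases le_total w (2 * δ) with h1 | h1
  · have h2 : max 1 (w / δ) ≤ 2 := max_le (by norm_num) ((div_le_iff₀ hδ).2 h1)
    have h3 := (hj δ w hδ).trans (mul_le_mul_of_nonneg_right h2 hjδ.le)
    linarith
  -- Here δ² ≤ w²/4 is absorbed on the left, and 112 · 4/3 < 150.
  have h2 : w ^ 2 ≤ 150 * b * j w := by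
    have : 4 * δ ^ 2 ≤ w ^ 2 := by nlinarith
    nlinarith [mul_pos hb hjw]
  have h3 : j w ≤ 150 * (j b ^ 2 / b) := by
    rcases le_total w b with h4 | h4
    · have h5 := hj b w hb
      rw [max_eq_left ((div_le_one hb).2 h4), one_mul] at h5
      have h6 : j b ≤ j b ^ 2 / b := by
        rw [le_div_iff₀ hb]; nlinarith [hjt b]
      linarith
    · have h5 := hj b w hb
      rw [max_eq_right ((one_le_div hb).2 h4)] at h5
      have h6 : w ≤ 150 * j b := by
        have : w * w ≤ 150 * j b * w := by
          calc w * w = w ^ 2 := by ring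
            _ ≤ 150 * b * j w := h2
            _ ≤ 150 * b * (w / b * j b) := by gcongr
            _ = _ := by field_simp
        exact le_of_mul_le_mul_right this hw
      calc j w ≤ w / b * j b := h5
        _ ≤ 150 * j b / b * j b := by gcongr
        _ = _ := by ring
  linarith

/-- A measurable majorant on the sample space pulls back along the sample, so only the law of the
sample matters. -/
lemma outerExp_comp_le {Ω Y : Type*} [MeasurableSpace Ω] [MeasurableSpace Y] {μ : Measure Ω}
    {ξ : Ω → Y} (hξ : Measurable ξ) {Z : Y → ℝ≥0∞} {V : Y → ℝ≥0∞} (hV : Measurable V)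
    (hZV : ∀ y, Z y ≤ V y) : outerExp μ (fun ω => Z (ξ ω)) ≤ ∫⁻ y, V y ∂(μ.map ξ) := by
  rw [lintegral_map hV hξ]
  exact iInf_le_of_le (fun ω => V (ξ ω)) (iInf₂_le_of_le (hV.comp hξ) (fun ω => hZV _) le_rfl)

section Main

variable {X : Type*} [MeasurableSpace X] {n : ℕ}

lemma l2Norm_nonneg (P : Measure X) (F : X → ℝ) : 0 ≤ l2Norm P F := ENNReal.toReal_nonneg

lemma l2Norm_sq {P : Measure X} [IsProbabilityMeasure P] {F : X → ℝ} (hF : MemLp F 2 P) :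
    l2Norm P F ^ 2 = ∫ x, F x ^ 2 ∂P := by
  have h0 : 0 ≤ ∫ x, F x ^ 2 ∂P := integral_nonneg fun x => sq_nonneg _
  rw [l2Norm, hF.eLpNorm_eq_integral_rpow_norm (by norm_num) (by norm_num)]
  simp only [ENNReal.toReal_ofNat, Real.norm_eq_abs, Real.rpow_ofNat, sq_abs]
  rw [ENNReal.toReal_ofReal (by positivity), ← Real.rpow_ofNat, ← Real.rpow_mul h0]
  norm_num

lemma lintegral_pi_ofReal_mean_sq (hn : 1 ≤ n) {P : Measure X} [IsProbabilityMeasure P] {F : X → ℝ}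
    (hF : MemLp F 2 P) :
    ∫⁻ x, ENNReal.ofReal ((∑ i, F (x i) ^ 2) / n) ∂(Measure.pi fun _ : Fin n => P)
      = ENNReal.ofReal (l2Norm P F) ^ 2 := by
  have hn0 : (0 : ℝ) < n := by exact_mod_cast hn
  have hi : Integrable (fun x => F x ^ 2) P := hF.integrable_sq
  have hc : ∀ i : Fin n, Integrable (fun x : Fin n → X => F (x i) ^ 2)
      (Measure.pi fun _ : Fin n => P) := fun i =>
    integrable_comp_eval (μ := fun _ : Fin n => P) (f := fun x => F x ^ 2) hi
  rw [← ENNReal.ofReal_pow (l2Norm_nonneg P F), l2Norm_sq hF,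
    ← ofReal_integral_eq_lintegral_ofReal
      ((integrable_finsetSum _ fun i _ => hc i).div_const _)
      (Filter.Eventually.of_forall fun x => by positivity)]
  congr 1
  rw [integral_div, integral_finsetSum _ fun i _ => hc i]
  have : ∀ i : Fin n, ∫ x : Fin n → X, F (x i) ^ 2 ∂(Measure.pi fun _ : Fin n => P)
      = ∫ x, F x ^ 2 ∂P := fun i =>
    integral_comp_eval (μ := fun _ : Fin n => P) (f := fun x => F x ^ 2) hi.aestronglyMeasurable
  simp [this, hn0.ne']

end Main

/-! ### The self-bounding inequality for the radius -/

section Recursion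

variable {X : Type*} [MeasurableSpace X] {n : ℕ}

lemma lintegral_le_of_sq {α : Type*} [MeasurableSpace α] (μ : Measure α)
    [IsProbabilityMeasure μ] {h : α → ℝ≥0∞} (hh : AEMeasurable h μ) {c : ℝ≥0∞}
    (hc : ∫⁻ a, h a ^ 2 ∂μ ≤ c ^ 2) : ∫⁻ a, h a ∂μ ≤ c :=
  (ENNReal.pow_le_pow_left_iff two_ne_zero).1 ((sq_lintegral_le_lintegral_sq μ hh).trans hc)

lemma ofReal_sqrt_div_sq (hn : 1 ≤ n) {c : ℝ≥0∞} (hc : c ≠ ⊤) :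
    ENNReal.ofReal √(c.toReal / n) ^ 2 = c / n := by
  have hn0 : (0 : ℝ) < n := by exact_mod_cast hn
  rw [← ENNReal.ofReal_pow (Real.sqrt_nonneg _), Real.sq_sqrt (by positivity),
    ENNReal.ofReal_div_of_pos hn0, ENNReal.ofReal_toReal hc, ENNReal.ofReal_natCast]

/-- The symmetrized entropy bounds for `𝓕` and `𝓕²`, in terms of the random `L₂`-radius of `𝓕`. -/
lemma exists_entropy_majorants (hn : 1 ≤ n) {P : Measure X} [IsProbabilityMeasure P]
    {𝓕 : Set (X → ℝ)} {F : X → ℝ} {δ : ℝ} (h𝓕 : ∀ f ∈ 𝓕, Measurable f)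
    (hF : IsEnvelope F 𝓕) (hF1 : ∀ x, F x ≤ 1) (hP : PMeasurable P n 𝓕)
    (hP2 : PMeasurable P n (sqClass 𝓕)) (hδ : 0 < δ)
    (hδf : ∀ f ∈ 𝓕, ∫ x, f x ^ 2 ∂P < δ ^ 2 * ∫ x, F x ^ 2 ∂P)
    (hF2 : MemLp F 2 P) (hN : 0 < l2Norm P F) (hfin : ∀ t, entropyIntegral 𝓕 F t ≠ ⊤) :
    ∃ w : ℝ, 0 < w ∧
      w ^ 2 ≤ δ ^ 2 + 112 * (1 / (√n * l2Norm P F)) * (entropyIntegral 𝓕 F w).toReal ∧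
      ∃ V : (Fin n → X) → ℝ≥0∞, Measurable V ∧
        (∀ x, ∀ f ∈ 𝓕, ENNReal.ofReal |∑ i, (f (x i) - ∫ y, f y ∂P)| ≤ V x) ∧
        ∫⁻ x, V x ∂(Measure.pi fun _ : Fin n => P)
          ≤ 56 * ENNReal.ofReal √n * (entropyIntegral 𝓕 F w * ENNReal.ofReal (l2Norm P F)) := by
  have hn0 : (0 : ℝ) < n := by exact_mod_cast hn
  set N := l2Norm P F with hNdef
  set μ := Measure.pi fun _ : Fin n => P with hμ
  have hf1 : ∀ f ∈ 𝓕, ∀ x, |f x| ≤ 1 := fun f hf x => (hF.2 f hf x).trans (hF1 x)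
  have hfint : ∀ f ∈ 𝓕, Integrable f P := fun f hf =>
    Integrable.of_bound (h𝓕 f hf).aestronglyMeasurable 1
      (Filter.Eventually.of_forall fun x => hf1 f hf x)
  have hgint : ∀ g ∈ sqClass 𝓕, Integrable g P := by
    rintro _ ⟨f, hf, rfl⟩
    refine Integrable.of_bound ((h𝓕 f hf).pow_const 2).aestronglyMeasurable 1
      (Filter.Eventually.of_forall fun x => ?_)
    simpa using hf1 f hf x
  -- This is n θ². It is the symmetrized supremum over 𝓕² with all signs +1, which is why it is a.e.
  -- measurable.
  set D : (Fin n → X) → ℝ≥0∞ := fun x => ⨆ g ∈ sqClass 𝓕, ENNReal.ofReal |∑ i, g (x i)| with hD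
  have hDn : ∀ x, D x ≤ n := by
    intro x
    refine iSup₂_le ?_
    rintro _ ⟨f, hf, rfl⟩
    rw [← ENNReal.ofReal_natCast]
    refine ENNReal.ofReal_le_ofReal ?_
    rw [abs_of_nonneg (by positivity)]
    calc ∑ i, f (x i) ^ 2 ≤ ∑ _i : Fin n, (1 : ℝ) :=
          Finset.sum_le_sum fun i _ => by simpa using hf1 f hf (x i)
      _ = n := by simp
  have hDtop : ∀ x, D x ≠ ⊤ := fun x => ne_top_of_le_ne_top (ENNReal.natCast_ne_top n) (hDn x)
  have hDm : AEMeasurable D μ := by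
    have := (hP2 (fun _ => 1) fun _ => Or.inl rfl).aemeasurable
    simpa only [one_mul] using this
  set E := ∫⁻ x, D x ∂μ with hE
  have hEtop : E ≠ ⊤ := by
    refine ne_top_of_le_ne_top (ENNReal.natCast_ne_top n) ((lintegral_mono hDn).trans_eq ?_)
    simp
  set θ : (Fin n → X) → ℝ := fun x => √((D x).toReal / n) with hθ
  have hθm : AEMeasurable (fun x => ENNReal.ofReal (θ x)) μ :=
    (hDm.ennreal_toReal.div_const _).sqrt.ennreal_ofReal
  have hθf : ∀ x, ∀ f ∈ 𝓕, ∑ i, f (x i) ^ 2 ≤ n * θ x ^ 2 := by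
    intro x f hf
    rw [hθ, Real.sq_sqrt (by positivity), mul_div_cancel₀ _ hn0.ne',
      ← ENNReal.ofReal_le_iff_le_toReal (hDtop x)]
    refine le_iSup₂_of_le (fun y => f y ^ 2) ⟨f, hf, rfl⟩ ?_
    exact ENNReal.ofReal_le_ofReal (le_abs_self _)
  set Θ := √(E.toReal / n) with hΘ
  have hΘ2 : ENNReal.ofReal Θ ^ 2 = E / n := ofReal_sqrt_div_sq hn hEtop
  have hθint : ∫⁻ x, ENNReal.ofReal (θ x) ∂μ ≤ ENNReal.ofReal Θ := by
    refine lintegral_le_of_sq μ hθm ?_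
    have hsq : ∀ x, ENNReal.ofReal (θ x) ^ 2 = D x * (n : ℝ≥0∞)⁻¹ := fun x =>
      ofReal_sqrt_div_sq hn (hDtop x)
    simp only [hsq, hΘ2]
    rw [lintegral_mul_const'' _ hDm, div_eq_mul_inv]
  have hMm : Measurable fun x : Fin n → X => ENNReal.ofReal √((∑ i, F (x i) ^ 2) / n) := by
    have := hF.1
    fun_prop
  have hMint : ∫⁻ x, ENNReal.ofReal √((∑ i, F (x i) ^ 2) / n) ∂μ ≤ ENNReal.ofReal N := by
    refine lintegral_le_of_sq μ hMm.aemeasurable (le_of_eq ?_)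
    rw [← lintegral_pi_ofReal_mean_sq hn hF2]
    refine lintegral_congr fun x => ?_
    rw [← ENNReal.ofReal_pow (Real.sqrt_nonneg _), Real.sq_sqrt (by positivity)]
  -- Θ/N makes Θ/w ≤ N, so M and θ/w both have mean at most N; δ keeps w positive.
  set w := max (Θ / N) δ with hw
  have hw0 : 0 < w := lt_max_of_lt_right hδ
  set J := entropyIntegral 𝓕 F w with hJ
  have hΘw : ENNReal.ofReal Θ / ENNReal.ofReal w ≤ ENNReal.ofReal N := by
    rw [← ENNReal.ofReal_div_of_pos hw0]
    refine ENNReal.ofReal_le_ofReal ((div_le_iff₀ hw0).2 ?_)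
    rw [mul_comm]
    exact (div_le_iff₀ hN).1 (le_max_left _ _)
  have hradius : ∫⁻ x, (ENNReal.ofReal √((∑ i, F (x i) ^ 2) / n)
      + ENNReal.ofReal (θ x) / ENNReal.ofReal w) ∂μ ≤ 2 * ENNReal.ofReal N := by
    simp only [div_eq_mul_inv (ENNReal.ofReal (θ _))]
    rw [lintegral_add_left hMm, lintegral_mul_const'' _ hθm, two_mul]
    refine add_le_add hMint (le_trans ?_ hΘw)
    rw [div_eq_mul_inv]
    gcongr
  -- The factor 4 is 2 from symmetrization times 2 from the two summands of the radius. With c = 14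
  -- and c = 28 it gives 56 and 112.
  have hbound : ∀ (c : ℝ≥0∞) (S : (Fin n → X) → ℝ≥0∞) (V : (Fin n → X) → ℝ≥0∞), c ≠ ⊤ →
      (∀ x, S x ≤ 2 ^ n * (c * ENNReal.ofReal √n * (J *
        (ENNReal.ofReal √((∑ i, F (x i) ^ 2) / n) + ENNReal.ofReal (θ x) / ENNReal.ofReal w)))) →
      2 ^ n * ∫⁻ x, V x ∂μ ≤ 2 * ∫⁻ x, S x ∂μ →
      ∫⁻ x, V x ∂μ ≤ 4 * c * ENNReal.ofReal √n * (J * ENNReal.ofReal N) := by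
    intro c S V hc hS hV
    have h1 : ∫⁻ x, S x ∂μ ≤ 2 ^ n * (c * ENNReal.ofReal √n * (J * (2 * ENNReal.ofReal N))) := by
      refine (lintegral_mono hS).trans ?_
      rw [lintegral_const_mul' _ _ (by simp), lintegral_const_mul' _ _
        (ENNReal.mul_ne_top hc ENNReal.ofReal_ne_top), lintegral_const_mul' _ _ (hfin w)]
      gcongr
    have h2 : 2 ^ n * ∫⁻ x, V x ∂μ
        ≤ 2 ^ n * (4 * c * ENNReal.ofReal √n * (J * ENNReal.ofReal N)) := by
      refine hV.trans ((mul_le_mul_right h1 2).trans_eq ?_)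
      ring
    exact (ENNReal.mul_le_mul_iff_right (by simp) (by simp)).1 h2
  obtain ⟨V, hVm, hV, hVint⟩ := exists_measurable_ge_symmetrized_average P hfint hP
  obtain ⟨V', hVm', hV', hVint'⟩ := exists_measurable_ge_symmetrized_average P hgint hP2
  have hb := hbound 14 _ V (by simp) (fun x => sum_signVectors_iSup_class_le hn x h𝓕 hF
    (Real.sqrt_nonneg _) hw0 (hθf x)) hVint
  have hb' := hbound 28 _ V' (by simp) (fun x => sum_signVectors_iSup_sqClass_le hn x h𝓕 hF hF1
    (Real.sqrt_nonneg _) hw0 (hθf x)) hVint'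
  refine ⟨w, hw0, ?_, V, hVm, hV, hb.trans_eq (by rw [← hJ]; norm_num)⟩
  change w ^ 2 ≤ δ ^ 2 + 112 * (1 / (√n * N)) * J.toReal
  -- Centring f² splits the empirical second moment into P f² < δ² N² and the empirical process over
  -- 𝓕², which closes the recursion.
  have hED : E ≤ ENNReal.ofReal (n * (δ ^ 2 * N ^ 2)) + ∫⁻ x, V' x ∂μ := by
    calc E ≤ ∫⁻ x, (ENNReal.ofReal (n * (δ ^ 2 * N ^ 2)) + V' x) ∂μ := by
          refine lintegral_mono fun x => iSup₂_le fun g hg => ?_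
          refine le_trans ?_ (add_le_add le_rfl (hV' x g hg))
          refine le_trans (ENNReal.ofReal_le_ofReal ?_) ENNReal.ofReal_add_le
          obtain ⟨f, hf, rfl⟩ := hg
          have h1 : ∫ x, f x ^ 2 ∂P ≤ δ ^ 2 * N ^ 2 := by
            rw [hNdef, l2Norm_sq hF2]; exact (hδf f hf).le
          have h0 : 0 ≤ ∫ x, f x ^ 2 ∂P := integral_nonneg fun x => sq_nonneg _
          have h2 : ∑ i, f (x i) ^ 2
              = n * ∫ x, f x ^ 2 ∂P + ∑ i, (f (x i) ^ 2 - ∫ y, f y ^ 2 ∂P) := by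
            simp [Finset.sum_sub_distrib]
          show |∑ i, f (x i) ^ 2| ≤ _
          rw [h2]
          refine (abs_add_le _ _).trans (add_le_add ?_ le_rfl)
          rw [abs_of_nonneg (by positivity)]
          gcongr
      _ = _ := by rw [lintegral_add_left measurable_const]; simp
  have hreal : E.toReal ≤ n * (δ ^ 2 * N ^ 2) + 112 * √n * (J.toReal * N) := by
    have h1 : E ≤ ENNReal.ofReal (n * (δ ^ 2 * N ^ 2) + 112 * √n * (J.toReal * N)) := by
      refine hED.trans ?_
      have hJ0 : 0 ≤ J.toReal := ENNReal.toReal_nonneg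
      rw [ENNReal.ofReal_add (by positivity) (by positivity),
        ENNReal.ofReal_mul (by positivity) (p := 112 * √n), ENNReal.ofReal_mul (by norm_num),
        ENNReal.ofReal_mul hJ0, ENNReal.ofReal_toReal (show J ≠ ⊤ from hfin w)]
      refine add_le_add le_rfl (hb'.trans_eq ?_)
      norm_num
    exact ENNReal.toReal_le_of_le_ofReal (by positivity) h1
  have hj0 : 0 ≤ 112 * (1 / (√n * N)) * J.toReal := by positivity
  rcases max_choice (Θ / N) δ with h | h
  · have h1 : w ^ 2 = E.toReal / (n * N ^ 2) := by
      rw [hw, h, div_pow, hΘ, Real.sq_sqrt (by positivity), div_div]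
    rw [h1, div_le_iff₀ (by positivity)]
    refine hreal.trans_eq ?_
    have hs : √(n : ℝ) ^ 2 = n := Real.sq_sqrt hn0.le
    have hs0 : √(n : ℝ) ≠ 0 := (Real.sqrt_pos.2 hn0).ne'
    generalize √(n : ℝ) = s at *
    rw [← hs]
    field_simp
  · have : w ^ 2 = δ ^ 2 := congrArg (· ^ 2) h
    linarith

end Recursion

/-! ### The maximal inequality and the simplified bound -/

section Conclusion

variable {X : Type*} [MeasurableSpace X] {n : ℕ}

lemma supNormG_le (P : Measure X) (x : Fin n → X) {𝓕 : Set (X → ℝ)} {c : ℝ≥0∞}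
    (hc : ∀ f ∈ 𝓕, ENNReal.ofReal |∑ i, (f (x i) - ∫ y, f y ∂P)| ≤ c) :
    supNormG P x 𝓕 ≤ ENNReal.ofReal (1 / √n) * c := by
  refine iSup₂_le fun f hf => ?_
  rw [empiricalG, abs_mul, abs_of_nonneg (by positivity), ENNReal.ofReal_mul (by positivity)]
  gcongr
  exact hc f hf

/-- For N > 0 the condition reads δ ≤ 1/(sN), so the larger entropy integral is at most 1/(sNδ)
times the one at δ. For N = 0 both sides vanish, since 0 · ∞ = 0. -/
lemma entropyIntegral_sq_mul_le {𝓕 : Set (X → ℝ)} {F : X → ℝ} {δ N s : ℝ} (hδ : 0 < δ)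
    (hN : 0 ≤ N) (hs : 0 < s) (h : δ * N ≤ 1 / s) :
    entropyIntegral 𝓕 F δ * ENNReal.ofReal N
        + entropyIntegral 𝓕 F (1 / (s * N)) ^ 2 * ENNReal.ofReal (s * N ^ 2)
      ≤ entropyIntegral 𝓕 F δ
        * (1 + entropyIntegral 𝓕 F δ / ENNReal.ofReal (δ ^ 2 * s * N)) * ENNReal.ofReal N := by
  rcases hN.eq_or_lt with rfl | hN
  · simp
  rw [mul_add, mul_one, add_mul]
  refine add_le_add le_rfl ?_
  have hb : 1 ≤ 1 / (s * N) / δ := by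
    rw [one_le_div hδ, le_div_iff₀ (by positivity)]
    rw [le_div_iff₀ hs] at h
    linarith
  have h1 := entropyIntegral_le_ofReal_mul 𝓕 F (1 / (s * N)) hδ
  rw [max_eq_right hb] at h1
  calc entropyIntegral 𝓕 F (1 / (s * N)) ^ 2 * ENNReal.ofReal (s * N ^ 2)
      ≤ (ENNReal.ofReal (1 / (s * N) / δ) * entropyIntegral 𝓕 F δ) ^ 2
          * ENNReal.ofReal (s * N ^ 2) := by gcongr
    _ = entropyIntegral 𝓕 F δ * entropyIntegral 𝓕 F δ *
          ENNReal.ofReal ((1 / (s * N) / δ) ^ 2 * (s * N ^ 2)) := by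
        rw [ENNReal.ofReal_mul (by positivity) (p := (1 / (s * N) / δ) ^ 2),
          ENNReal.ofReal_pow (by positivity)]
        ring
    _ = entropyIntegral 𝓕 F δ * entropyIntegral 𝓕 F δ *
          ENNReal.ofReal ((δ ^ 2 * s * N)⁻¹ * N) := by
        congr 2
        field_simp
    _ = _ := by
        rw [ENNReal.ofReal_mul (by positivity), ENNReal.ofReal_inv_of_pos (by positivity),
          div_eq_mul_inv]
        ring

/-- The local maximal inequality for a sample `ξ₁, …, ξₙ` with law `P`. -/
lemma outerExp_supNormG_le {P : Measure X} [IsProbabilityMeasure P] {Ω : Type*}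
    [MeasurableSpace Ω] {μ : Measure Ω} (hn : 1 ≤ n) {ξ : Fin n → Ω → X}
    (hξ : ∀ i, Measurable (ξ i))
    (hmap : μ.map (fun ω i => ξ i ω) = Measure.pi fun _ : Fin n => P)
    {𝓕 : Set (X → ℝ)} {F : X → ℝ} {δ : ℝ} (h𝓕 : ∀ f ∈ 𝓕, Measurable f)
    (hF : IsEnvelope F 𝓕) (hF1 : ∀ x, F x ≤ 1) (hP : PMeasurable P n 𝓕)
    (hP2 : PMeasurable P n (sqClass 𝓕)) (hδ : 0 < δ)
    (hδf : ∀ f ∈ 𝓕, ∫ x, f x ^ 2 ∂P < δ ^ 2 * ∫ x, F x ^ 2 ∂P) :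
    outerExp μ (fun ω => supNormG P (fun i => ξ i ω) 𝓕)
      ≤ ENNReal.ofReal 8400 * (entropyIntegral 𝓕 F δ * ENNReal.ofReal (l2Norm P F)
        + entropyIntegral 𝓕 F (1 / (√(n : ℝ) * l2Norm P F)) ^ 2
          * ENNReal.ofReal (√(n : ℝ) * l2Norm P F ^ 2)) := by
  have hn0 : (0 : ℝ) < n := by exact_mod_cast hn
  have hs0 : 0 < √(n : ℝ) := Real.sqrt_pos.2 hn0
  rcases 𝓕.eq_empty_or_nonempty with rfl | ⟨f₀, hf₀⟩
  · refine (iInf_le_of_le 0 (iInf₂_le_of_le measurable_zero (fun ω => ?_) le_rfl)).trans ?_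
    · simp [supNormG]
    · simp
  have hF2 : MemLp F 2 P := by
    refine MemLp.of_bound hF.1.aestronglyMeasurable 1 (Filter.Eventually.of_forall fun x => ?_)
    have h0 : 0 ≤ F x := (abs_nonneg _).trans (hF.2 f₀ hf₀ x)
    rw [Real.norm_eq_abs, abs_of_nonneg h0]
    exact hF1 x
  -- The strict inequality P f₀² < δ² P F² excludes a null envelope.
  have hN : 0 < l2Norm P F := by
    refine lt_of_le_of_ne (l2Norm_nonneg P F) fun h => ?_
    have h1 := hδf f₀ hf₀
    rw [← l2Norm_sq hF2, ← h] at h1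
    have h2 : 0 ≤ ∫ x, f₀ x ^ 2 ∂P := integral_nonneg fun x => sq_nonneg _
    simp only [ne_eq, OfNat.ofNat_ne_zero, not_false_eq_true, zero_pow, mul_zero] at h1
    exact absurd h1 (not_lt.2 h2)
  by_cases htop : entropyIntegral 𝓕 F δ = ⊤
  · rw [htop, ENNReal.top_mul (by simpa using hN), top_add, ENNReal.mul_top (by simp)]
    exact le_top
  -- Finiteness at δ propagates to all upper limits, so the recursion can be solved in the reals.
  have hfin : ∀ t, entropyIntegral 𝓕 F t ≠ ⊤ := fun t =>
    ne_top_of_le_ne_top (ENNReal.mul_ne_top ENNReal.ofReal_ne_top htop)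
      (entropyIntegral_le_ofReal_mul 𝓕 F t hδ)
  obtain ⟨w, hw, hwle, V, hVm, hV, hVint⟩ :=
    exists_entropy_majorants hn h𝓕 hF hF1 hP hP2 hδ hδf hF2 hN hfin
  have : Nonempty X := P.nonempty_of_neZero
  set N := l2Norm P F with hNdef
  set b := 1 / (√n * N) with hb
  have hb0 : 0 < b := by positivity
  set j : ℝ → ℝ := fun t => (entropyIntegral 𝓕 F t).toReal with hj
  have hJj : ∀ t, entropyIntegral 𝓕 F t = ENNReal.ofReal (j t) := fun t =>
    (ENNReal.ofReal_toReal (hfin t)).symm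
  have hj0 : ∀ t, 0 ≤ j t := fun t => ENNReal.toReal_nonneg
  have hkey : j w ≤ 150 * (j δ + j b ^ 2 / b) := by
    refine le_of_sq_le_add_mul (fun s t hs => ?_) (fun t => ?_) hδ hb0 hw hwle
    · refine ENNReal.toReal_le_of_le_ofReal (mul_nonneg (by positivity) (hj0 s)) ?_
      rw [ENNReal.ofReal_mul (by positivity), ← hJj]
      exact entropyIntegral_le_ofReal_mul 𝓕 F t hs
    · exact (ENNReal.ofReal_le_iff_le_toReal (hfin t)).1 (ofReal_le_entropyIntegral 𝓕 F t)
  have hreal : 56 * (j w * N) ≤ 8400 * (j δ * N + j b ^ 2 * (√n * N ^ 2)) := by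
    have hNb : N / b = √n * N ^ 2 := by rw [hb]; field_simp
    calc 56 * (j w * N) ≤ 56 * (150 * (j δ + j b ^ 2 / b) * N) := by gcongr
      _ = 8400 * (j δ * N + j b ^ 2 * (N / b)) := by ring
      _ = _ := by rw [hNb]
  have hleft : ENNReal.ofReal (1 / √n) * ∫⁻ x, V x ∂(Measure.pi fun _ : Fin n => P)
      ≤ ENNReal.ofReal (56 * (j w * N)) := by
    have heq : ENNReal.ofReal (56 * (j w * N)) = ENNReal.ofReal (1 / √n)
        * (56 * ENNReal.ofReal √n * (entropyIntegral 𝓕 F w * ENNReal.ofReal N)) := by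
      rw [hJj, ← ENNReal.ofReal_mul (hj0 w), ← ENNReal.ofReal_ofNat 56,
        ← ENNReal.ofReal_mul (by norm_num), ← ENNReal.ofReal_mul (by positivity),
        ← ENNReal.ofReal_mul (by positivity)]
      congr 1
      field_simp
    rw [heq]
    gcongr
  have hright : ENNReal.ofReal (8400 * (j δ * N + j b ^ 2 * (√n * N ^ 2)))
      = ENNReal.ofReal 8400 * (entropyIntegral 𝓕 F δ * ENNReal.ofReal N
        + entropyIntegral 𝓕 F b ^ 2 * ENNReal.ofReal (√n * N ^ 2)) := by
    have h1 := hj0 δ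
    have h2 := hj0 b
    rw [ENNReal.ofReal_mul (by norm_num), ENNReal.ofReal_add (by positivity) (by positivity),
      ENNReal.ofReal_mul h1, ENNReal.ofReal_mul (by positivity), ENNReal.ofReal_pow h2,
      ← hJj, ← hJj]
  have houter := outerExp_comp_le (μ := μ) (measurable_pi_lambda _ hξ)
    (hVm.const_mul (ENNReal.ofReal (1 / √n))) fun x => supNormG_le P x (hV x)
  rw [hmap, lintegral_const_mul _ hVm] at houter
  rw [← hright]
  exact (houter.trans hleft).trans (ENNReal.ofReal_le_ofReal hreal)

end Conclusion

end LocalMaximal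

open LocalMaximal in
theorem mainTheorem2 :
    ∃ C : ℝ≥0, ∀ (X : Type u) [MeasurableSpace X] (P : Measure X) [IsProbabilityMeasure P]
      (Ω : Type v) [MeasurableSpace Ω] (μ : Measure Ω) [IsProbabilityMeasure μ]
      (n : ℕ) (_ : 1 ≤ n) (ξ : Fin n → Ω → X)
      (_ : ∀ i, Measurable (ξ i)) (_ : ∀ i, μ.map (ξ i) = P) (_ : iIndepFun ξ μ)
      (𝓕 : Set (X → ℝ)) (F : X → ℝ) (δ : ℝ)
      (_ : ∀ f ∈ 𝓕, Measurable f)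
      (_ : IsEnvelope F 𝓕) (_ : ∀ x, F x ≤ 1)
      (_ : PMeasurable P n 𝓕) (_ : PMeasurable P n (sqClass 𝓕))
      (_ : 0 < δ) (_ : δ < 1)
      (_ : ∀ f ∈ 𝓕, ∫ x, f x ^ 2 ∂P < δ ^ 2 * ∫ x, F x ^ 2 ∂P),
      outerExp μ (fun ω => supNormG P (fun i => ξ i ω) 𝓕)
          ≤ C * (entropyIntegral 𝓕 F δ * ENNReal.ofReal (l2Norm P F)
            + entropyIntegral 𝓕 F (1 / (√(n : ℝ) * l2Norm P F)) ^ 2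
              * ENNReal.ofReal (√(n : ℝ) * l2Norm P F ^ 2)) ∧
      (δ * l2Norm P F ≤ 1 / √(n : ℝ) →
        entropyIntegral 𝓕 F δ * ENNReal.ofReal (l2Norm P F)
            + entropyIntegral 𝓕 F (1 / (√(n : ℝ) * l2Norm P F)) ^ 2
              * ENNReal.ofReal (√(n : ℝ) * l2Norm P F ^ 2)
          ≤ entropyIntegral 𝓕 F δ
            * (1 + entropyIntegral 𝓕 F δ / ENNReal.ofReal (δ ^ 2 * √(n : ℝ) * l2Norm P F))
            * ENNReal.ofReal (l2Norm P F)) := by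
  refine ⟨Real.toNNReal 8400, ?_⟩
  intro X _ P _ Ω _ μ _ n hn ξ hξ hlaw hind 𝓕 F δ h𝓕 hF hF1 hP hP2 hδ _ hδf
  have hn0 : (0 : ℝ) < n := by exact_mod_cast hn
  have hs0 : 0 < √(n : ℝ) := Real.sqrt_pos.2 hn0
  refine ⟨outerExp_supNormG_le hn hξ ?_ h𝓕 hF hF1 hP hP2 hδ hδf,
    fun h => entropyIntegral_sq_mul_le hδ (l2Norm_nonneg P F) hs0 h⟩
  -- Independence and identical laws enter only through the joint law Pⁿ.
  rw [(iIndepFun_iff_map_fun_eq_pi_map fun i => (hξ i).aemeasurable).1 hind]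
  simp only [hlaw]
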